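/- Let $\mu\ge 0$, $n\ge 0$, and let $\Pi_n^2$ be the space of real polynomials in two variables of total degree at most $n$. Write $(b)_k=b(b+1)\cdots(b+k-1)$, let $C_k^{\lambda}$ be the Gegenbauer polynomials (so $C_0^\lambda=1$, $C_1^\lambda(t)=2\lambda t$, $kC_k^\lambda(t)=2(k+\lambda-1)tC_{k-1}^\lambda(t)-(k+2\lambda-2)C_{k-2}^\lambda(t)$ for $k\ge 2$), and let $p_l^{(\alpha,\beta)}$ be the Jacobi polynomials, orthonormal with respect to the weight $(1-t)^\alpha(1+t)^\beta$ on $[-1,1]$ normalized to have integral one. *Radon data.* For a function $f$ on the unit disk $B^2$, $\theta\in\mathbb R$ and $t\in(-1,1)$, the attenuated Radon projection is $$\mathcal R_\theta^\mu(f;t)=\int_{-\sqrt{1-t^2}}^{\sqrt{1-t^2}} f(t\cos\theta-s\sin\theta,\;t\sin\theta+s\cos\theta)\,(1-s^2-t^2)^{\mu-1/2}\,ds .$$ *Kernel.* For $0\le 2l\le k$ and $\varepsilon\in\{0,1\}$ (with $2l<k$ if $\varepsilon=1$), set in polar coordinates $x=r\cos\phi$, $y=r\sin\phi$ $$P_{l,\varepsilon}^k(x,y)=h_{l,k}\,p_l^{(\mu-\frac12,\,k-2l)}(2r^2-1)\,r^{k-2l}S_{k-2l,\varepsilon}(\phi),\qquad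 S_{m,0}(\phi)=\cos m\phi,\quad S_{m,1}(\phi)=\sin m\phi,$$ $$h_{l,k}>0,\qquad h_{l,k}^2=\delta_{l,k}\,\frac{\Gamma(k-2l+\mu+\frac32)}{\Gamma(\mu+\frac32)\,\Gamma(k-2l+1)},\qquad \delta_{l,k}=1\text{ if }2l=k,\quad \delta_{l,k}=2\text{ if }2l<k .$$ (For fixed $k$ these form an orthonormal basis of the orthogonal polynomials of degree $k$ for the weight $a_\mu(1-x^2-y^2)^{\mu-1/2}$ on $B^2$, where $a_\mu=(\mu+\frac12)/\pi$.) Put $$D_k^{\mu+\frac12}(\xi;x,y)=\sum_{l,\varepsilon}\lambda_{l,k}\,P_{l,\varepsilon}^k(\cos\xi,\sin\xi)\,P_{l,\varepsilon}^k(x,y),\qquad \lambda_{l,k}^{-1}=\frac{(\mu+\frac12)_l\,(\mu+\frac32)_{k-l}\,(k+\mu+\frac12)}{l!\,(k-l)!\,(k-l+\mu+\frac12)},$$ $$\Phi_n^\mu(\xi,t;x,y)=\sum_{k=0}^n\frac{k+\mu+\frac12}{\mu+\frac12}\,C_k^{\mu+\frac12}(t)\,D_k^{\mu+\frac12}(\xi;x,y).$$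 *Reconstruction operator.* Let $a\in\mathbb R$ be such that the quasi-orthogonal polynomial $C_{n+1}^{\mu+\frac12}+aC_n^{\mu+\frac12}$ has $n+1$ distinct zeros $t_0,\dots,t_n$ in $(-1,1)$. Let $\lambda_j=\int_{-1}^1\ell_j(t)(1-t^2)^\mu\,dt$, with $\ell_j$ the Lagrange polynomials of the nodes $t_0,\dots,t_n$, be the weights of the interpolatory quadrature at these nodes for the weight function $(1-t^2)^\mu$ on $[-1,1]$. With $\xi_\nu=\nu\pi/(n+1)$, define $$\mathcal A_n^\mu(f;x,y)=\sum_{\nu=0}^n\sum_{j=0}^n\mathcal R^\mu_{\xi_\nu}(f;t_j)\;\frac{a_\mu\lambda_j}{n+1}\,(1-t_j^2)^{-\mu}\,\Phi_n^\mu(\xi_\nu,t_j;x,y).$$ **Theorem.** The operator $\mathcal A_n^\mu$ is a projection operator on $\Pi_n^2$: $\mathcal A_n^\mu f\in\Pi_n^2$ for every $f$ (for which the data are defined), and $\mathcal A_n^\mu P=P$ for every $P\in\Pi_n^2$. -/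

import Mathlib

noncomputable section

namespace AttenuatedRadon

open Polynomial

/-- The Pochhammer symbol `(a)_k = a (a + 1) ⋯ (a + k - 1)`. -/
def poch (a : ℝ) (k : ℕ) : ℝ := (ascPochhammer ℝ k).eval a

/-- The Gegenbauer polynomial `C_k^lam`, by its three-term recurrence
`k C_k = 2 (k + lam - 1) X C_{k-1} - (k + 2 lam - 2) C_{k-2}`. -/
def gegenbauer (lam : ℝ) : ℕ → ℝ[X]
  | 0 => 1
  | 1 => C (2 * lam) * X
  | (k + 2) =>
      C (2 * ((k : ℝ) + 1 + lam) / ((k : ℝ) + 2)) * X * gegenbauer lam (k + 1)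
        - C (((k : ℝ) + 2 * lam) / ((k : ℝ) + 2)) * gegenbauer lam k

/-- The classical (not normalized) Jacobi polynomial `P_n^{(α,β)}`. -/
def jacobi (α β : ℝ) (n : ℕ) (t : ℝ) : ℝ :=
  ∑ j ∈ Finset.range (n + 1),
    poch (α + j + 1) (n - j) * poch (α + β + n + 1) j
      / ((j.factorial : ℝ) * ((n - j).factorial : ℝ)) * ((t - 1) / 2) ^ j

/-- The Jacobi weight `(1 - t)^α (1 + t)^β` on `[-1, 1]`. -/
def jacobiWeight (α β t : ℝ) : ℝ := (1 - t) ^ α * (1 + t) ^ β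

/-- The orthonormal Jacobi polynomial `p_n^{(α,β)}`: the classical one divided by its norm with
respect to the Jacobi weight normalized to have integral one. -/
def jacobiON (α β : ℝ) (n : ℕ) (t : ℝ) : ℝ :=
  jacobi α β n t /
    Real.sqrt ((∫ s in (-1 : ℝ)..1, jacobi α β n s ^ 2 * jacobiWeight α β s) /
      ∫ s in (-1 : ℝ)..1, jacobiWeight α β s)

/-- The weight `W_μ(x, y) = (1 - x² - y²)^(μ - 1/2)` on the unit disk. -/
def diskWeight (μ x y : ℝ) : ℝ := (1 - x ^ 2 - y ^ 2) ^ (μ - 1 / 2)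

/-- The normalization constant `a_μ = 1 / ∫_{B²} W_μ = (μ + 1/2) / π`. -/
def diskConst (μ : ℝ) : ℝ := (μ + 1 / 2) / Real.pi

/-- The attenuated Radon projection of `f` in the direction `θ` with parameter `t`: the integral of
`f W_μ` over the segment cut out of the unit disk by the line `x cos θ + y sin θ = t`. As `W_μ` is
rotation invariant, its value at the point with parameter `s` is `W_μ(s, t)`. -/
def radon (μ : ℝ) (f : ℝ → ℝ → ℝ) (θ t : ℝ) : ℝ :=
  ∫ s in (-Real.sqrt (1 - t ^ 2))..Real.sqrt (1 - t ^ 2),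
    f (t * Real.cos θ - s * Real.sin θ) (t * Real.sin θ + s * Real.cos θ) * diskWeight μ s t

/-- In polar coordinates `x = r cos φ`, `y = r sin φ`, this is `r^m cos (m φ)` for `ε = 0` and
`r^m sin (m φ)` for `ε = 1`. -/
def harmonic (m : ℕ) (ε : Fin 2) (x y : ℝ) : ℝ :=
  if ε = 0 then (((x : ℂ) + y * Complex.I) ^ m).re else (((x : ℂ) + y * Complex.I) ^ m).im

/-- The positive constant `h_{l,k}` that makes `diskBasis` orthonormal. -/
def basisConst (μ : ℝ) (k l : ℕ) : ℝ :=
  Real.sqrt ((if k = 2 * l then 1 else 2) *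
    (Real.Gamma (((k - 2 * l : ℕ) : ℝ) + μ + 3 / 2) /
      (Real.Gamma (μ + 3 / 2) * Real.Gamma (((k - 2 * l : ℕ) : ℝ) + 1))))

/-- The polynomials
`P_{l,ε}^k = h_{l,k} p_l^{(μ - 1/2, k - 2l)}(2 r² - 1) r^(k - 2l) S_{k-2l,ε}(φ)`, where `0 ≤ 2l ≤ k`
for `ε = 0` and `0 ≤ 2l < k` for `ε = 1`. They form an orthonormal basis of the space of orthogonal
polynomials of degree `k` for the weight `a_μ W_μ` on the disk. -/
def diskBasis (μ : ℝ) (k l : ℕ) (ε : Fin 2) (x y : ℝ) : ℝ :=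
  basisConst μ k l
    * jacobiON (μ - 1 / 2) ((k - 2 * l : ℕ) : ℝ) l (2 * (x ^ 2 + y ^ 2) - 1)
    * harmonic (k - 2 * l) ε x y

/-- The number `[H_{l,k}^μ]² = (μ+1/2)_l (μ+3/2)_{k-l} (k+μ+1/2) / (l! (k-l)! (k-l+μ+1/2))`;
for `μ = 1/2` it is `k + 1`. -/
def HSq (μ : ℝ) (k l : ℕ) : ℝ :=
  poch (μ + 1 / 2) l * poch (μ + 3 / 2) (k - l) * ((k : ℝ) + μ + 1 / 2) /
    ((l.factorial : ℝ) * ((k - l).factorial : ℝ) * (((k - l : ℕ) : ℝ) + μ + 1 / 2))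

/-- `D_k^{μ + 1/2}(ξ; x, y) = ∑ λ_{l,k} P_{l,ε}^k(cos ξ, sin ξ) P_{l,ε}^k(x, y)`, where
`λ_{l,k} = [H_{l,k}^μ]⁻²`. The sum is over the whole basis; the extra index `2l = k`, `ε = 1`
contributes zero. -/
def kernelD (μ : ℝ) (k : ℕ) (ξ x y : ℝ) : ℝ :=
  ∑ l ∈ Finset.range (k / 2 + 1), ∑ ε : Fin 2,
    (HSq μ k l)⁻¹ * diskBasis μ k l ε (Real.cos ξ) (Real.sin ξ) * diskBasis μ k l ε x y

/-- `Φ_n^μ(ξ, t; x, y)`. -/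
def kernelPhi (μ : ℝ) (n : ℕ) (ξ t x y : ℝ) : ℝ :=
  ∑ k ∈ Finset.range (n + 1),
    ((k : ℝ) + μ + 1 / 2) / (μ + 1 / 2) * (gegenbauer (μ + 1 / 2) k).eval t * kernelD μ k ξ x y

/-- The quasi-orthogonal polynomial `C_{n+1}^{μ + 1/2} + a C_n^{μ + 1/2}`. -/
def quasiOrthogonal (μ a : ℝ) (n : ℕ) : ℝ[X] :=
  gegenbauer (μ + 1 / 2) (n + 1) + C a * gegenbauer (μ + 1 / 2) n

/-- The weight `λ_j` of the interpolatory quadrature with nodes `t_0, …, t_n` for the weight function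
`(1 - s²)^μ` on `[-1, 1]`, that is, the integral of the `j`-th Lagrange polynomial. These are the
only weights on these nodes for which the quadrature can be exact in degree `n` or more. -/
def quadWeight (μ : ℝ) {n : ℕ} (t : Fin (n + 1) → ℝ) (j : Fin (n + 1)) : ℝ :=
  ∫ s in (-1 : ℝ)..1, (Lagrange.basis Finset.univ t j).eval s * (1 - s ^ 2) ^ μ

/-- The direction `ξ_ν = ν π / (n + 1)`. -/
def direction (n : ℕ) (ν : Fin (n + 1)) : ℝ := (ν : ℕ) * Real.pi / ((n : ℝ) + 1)

/-- The function `T_{j,ν}^μ(x, y)`. -/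
def reconT (μ : ℝ) {n : ℕ} (t : Fin (n + 1) → ℝ) (j ν : Fin (n + 1)) (x y : ℝ) : ℝ :=
  diskConst μ * quadWeight μ t j / ((n : ℝ) + 1) * (1 - t j ^ 2) ^ (-μ)
    * kernelPhi μ n (direction n ν) (t j) x y

/-- The reconstruction operator `A_n^μ`. -/
def recon (μ : ℝ) {n : ℕ} (t : Fin (n + 1) → ℝ) (f : ℝ → ℝ → ℝ) (x y : ℝ) : ℝ :=
  ∑ ν : Fin (n + 1), ∑ j : Fin (n + 1), radon μ f (direction n ν) (t j) * reconT μ t j ν x y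

end AttenuatedRadon

end

namespace AttenuatedRadon

open Polynomial

/-! ### Pochhammer symbols and normalized Jacobi polynomials -/

/-! Write `lam = μ + 1/2` and let `diskPoly lam m l ε` be the disk polynomial of degree `k = m + 2l`
whose radial factor is one on the unit circle. Marr's formula (`radon_diskPoly`) says that its Radon
projection factors: it is a constant times `(1 - t²)^μ`, times `C_k(t) / C_k(1)`, times the value of
the polynomial at `(cos θ, sin θ)`.

Insert this in the operator. The factor `(1 - t_j²)^(-μ)` cancels. The sum over `j` is a quadrature
of products `C_k C_k'` of degree at most `2n`, where the rule is exact (`quadrature_exact`), so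
Gegenbauer orthogonality leaves only the summand of degree `k` of the kernel
(`sum_quadWeight_mul_kernelPhi`). The constants in `D_k` are such that `D_k` becomes a sum of
trigonometric functions of `ξ` times `diskPoly`, with coefficient 1 or 2 (`kernelD_eq`). All
frequencies in it have the parity of `k`, and `cos`, `sin` with frequencies of equal parity up to
`n` are orthogonal on `n + 1` equispaced directions of a half circle. The sum over `ν` therefore
returns the original polynomial (`recon_diskPoly`).

The disk polynomials of degree at most `n` span all polynomials of that degree
(`eval_mem_diskSpan`), and linearity finishes the reproduction. The range is clear, because the
kernel is a polynomial of degree at most `n` in `(x, y)`.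

Two contiguous relations, `normJacobi_raise` and `normJacobi_lower`, carry everything about Jacobi
polynomials: orthogonality, norms, Marr's formula and the spanning property. -/

@[simp] lemma poch_zero (a : ℝ) : poch a 0 = 1 := by simp [poch]

lemma poch_succ (a : ℝ) (k : ℕ) : poch a (k + 1) = poch a k * (a + k) := by
  simp [poch, ascPochhammer_succ_right]

lemma poch_succ_left (a : ℝ) (k : ℕ) : poch a (k + 1) = a * poch (a + 1) k := by
  simp [poch, ascPochhammer_succ_left]

lemma poch_pos {a : ℝ} (ha : 0 < a) (k : ℕ) : 0 < poch a k := by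
  unfold poch; exact ascPochhammer_pos k a ha

lemma poch_mul_add (a : ℝ) (j d : ℕ) : poch a j * poch (a + j) d = poch a (j + d) := by
  induction d with
  | zero => simp
  | succ d ih =>
    rw [poch_succ, ← mul_assoc, ih, ← add_assoc, poch_succ]; push_cast; ring

lemma gamma_add_nat {a : ℝ} (ha : 0 < a) (k : ℕ) :
    Real.Gamma (a + k) = poch a k * Real.Gamma a := by
  induction k with
  | zero => simp
  | succ k ih =>
    push_cast
    rw [← add_assoc, Real.Gamma_add_one (by positivity), ih, poch_succ]; ring

/-- The Jacobi polynomial `P_l^{(lam - 1, m)}` with value one at `t = 1`, in the variable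
`w = (t - 1) / 2`. -/
noncomputable def normJacobi (lam : ℝ) (m l : ℕ) (w : ℝ) : ℝ :=
  ∑ j ∈ Finset.range (l + 1),
    (l.choose j : ℝ) * poch (lam + m + l) j / poch lam j * w ^ j

lemma normJacobi_eq_sum (lam : ℝ) (m l : ℕ) (w : ℝ) {N : ℕ} (hN : l + 1 ≤ N) :
    normJacobi lam m l w = ∑ j ∈ Finset.range N,
      (l.choose j : ℝ) * poch (lam + m + l) j / poch lam j * w ^ j := by
  unfold normJacobi
  refine Finset.sum_subset (Finset.range_mono hN) fun j _ hj => ?_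
  rw [Nat.choose_eq_zero_of_lt (by simpa using hj)]; simp

@[simp] lemma normJacobi_zero (lam : ℝ) (m : ℕ) (w : ℝ) : normJacobi lam m 0 w = 1 := by
  simp [normJacobi]

@[simp] lemma normJacobi_apply_zero (lam : ℝ) (m l : ℕ) : normJacobi lam m l 0 = 1 := by
  unfold normJacobi
  rw [Finset.sum_range_succ']; simp

lemma continuous_normJacobi (lam : ℝ) (m l : ℕ) : Continuous (normJacobi lam m l) := by
  unfold normJacobi; fun_prop

lemma jacobi_eq_normJacobi {lam : ℝ} (hlam : 0 < lam) (m l : ℕ) (t : ℝ) :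
    jacobi (lam - 1) m l t = poch lam l / l.factorial * normJacobi lam m l ((t - 1) / 2) := by
  unfold jacobi normJacobi
  rw [Finset.mul_sum]
  refine Finset.sum_congr rfl fun j hj => ?_
  obtain ⟨d, rfl⟩ := Nat.exists_eq_add_of_le (Nat.lt_succ_iff.mp (Finset.mem_range.mp hj))
  have h1 := poch_mul_add lam j d
  have h2 := (poch_pos hlam j).ne'
  have h3 := Nat.choose_mul_factorial_mul_factorial (Nat.le_add_right j d)
  rw [Nat.add_sub_cancel_left] at h3
  have h3' : ((j + d).choose j : ℝ) * j.factorial * d.factorial = (j + d).factorial := by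
    exact_mod_cast h3
  rw [← h1, ← h3', Nat.add_sub_cancel_left]
  have e1 : lam - 1 + j + 1 = lam + j := by ring
  have e2 : lam - 1 + m + ((j + d : ℕ) : ℝ) + 1 = lam + m + ((j + d : ℕ) : ℝ) := by ring
  rw [e1, e2]
  have h4 : ((j + d).choose j : ℝ) ≠ 0 := by
    exact_mod_cast (Nat.choose_pos (Nat.le_add_right j d)).ne'
  have h5 : (j.factorial : ℝ) ≠ 0 := by positivity
  have h6 : (d.factorial : ℝ) ≠ 0 := by positivity
  field_simp

/-- Holds coefficient by coefficient, from `y (y+1)_j = (y)_j (y+j)` and `(l+1) choose(l, j) =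
(l+1-j) choose(l+1, j)`. At `l = 0` the truncated index `l - 1` is harmless, its factor `l` being
zero. -/
lemma normJacobi_raise {lam : ℝ} (m l : ℕ) (w : ℝ) :
    (2 * l + lam + m) * normJacobi lam m l w =
      (l + lam + m) * normJacobi lam (m + 1) l w + l * normJacobi lam (m + 1) (l - 1) w := by
  rw [normJacobi_eq_sum lam (m + 1) (l - 1) w (N := l + 1) (by omega)]
  unfold normJacobi
  simp only [Finset.mul_sum, ← Finset.sum_add_distrib]
  refine Finset.sum_congr rfl fun j _ => ?_
  rcases l with _ | l
  · rcases j with _ | j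
    · simp
    · simp
  · have e1 : lam + ((m + 1 : ℕ) : ℝ) + ((l + 1 : ℕ) : ℝ) = lam + m + ((l + 1 : ℕ) : ℝ) + 1 := by
      push_cast; ring
    have e2 : lam + ((m + 1 : ℕ) : ℝ) + ((l + 1 - 1 : ℕ) : ℝ) = lam + m + ((l + 1 : ℕ) : ℝ) := by
      push_cast [Nat.add_sub_cancel]; ring
    rw [e1, e2, Nat.add_sub_cancel]
    set y := lam + m + ((l + 1 : ℕ) : ℝ) with hy
    have h1 : y * poch (y + 1) j = poch y j * (y + j) := by rw [← poch_succ_left, poch_succ]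
    have h2 : ((l + 1 : ℕ) : ℝ) * (l.choose j : ℝ) =
        (((l + 1 : ℕ) : ℝ) - j) * ((l + 1).choose j : ℝ) := by
      rcases le_or_gt j (l + 1) with h | h
      · have := Nat.add_one_mul_choose_eq l j
        have h3 := Nat.choose_mul_succ_eq l j
        rw [← Nat.cast_sub h]
        norm_cast
        rw [mul_comm, h3, mul_comm]
      · rw [Nat.choose_eq_zero_of_lt h, Nat.choose_eq_zero_of_lt (by omega)]; simp
    have e3 : ((l + 1 : ℕ) : ℝ) + lam + m = y := by rw [hy]; ring
    have e4 : 2 * ((l + 1 : ℕ) : ℝ) + lam + m = y + ((l + 1 : ℕ) : ℝ) := by rw [hy]; ring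
    rw [e3, e4]
    linear_combination (-((l + 1).choose j : ℝ) / poch lam j * w ^ j) * h1
      - (poch y j / poch lam j * w ^ j) * h2

/-- With `w = r² - 1` the factor `1 + w` is `r²`, or, up to a factor 2, the factor by which the
Jacobi weight changes from `m` to `m + 1`. Both readings are used later. -/
lemma normJacobi_lower {lam : ℝ} (hlam : 0 < lam) (m l : ℕ) (w : ℝ) :
    (2 * l + lam + m + 1) * ((1 + w) * normJacobi lam (m + 1) l w) =
      (l + lam) * normJacobi lam m (l + 1) w + (l + m + 1) * normJacobi lam m l w := by
  have key : ∀ j : ℕ, (2 * l + lam + m + 1) *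
      ((l.choose (j + 1) : ℝ) * poch (lam + (m + 1 : ℕ) + l) (j + 1) / poch lam (j + 1)
        + (l.choose j : ℝ) * poch (lam + (m + 1 : ℕ) + l) j / poch lam j) =
      (l + lam) * (((l + 1).choose (j + 1) : ℝ) * poch (lam + m + (l + 1 : ℕ)) (j + 1)
          / poch lam (j + 1))
        + (l + m + 1) * ((l.choose (j + 1) : ℝ) * poch (lam + m + l) (j + 1)
          / poch lam (j + 1)) := by
    intro j
    have e1 : lam + ((m + 1 : ℕ) : ℝ) + l = lam + m + l + 1 := by push_cast; ring
    have e2 : lam + m + ((l + 1 : ℕ) : ℝ) = lam + m + l + 1 := by push_cast; ring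
    rw [e1, e2, poch_succ_left (lam + m + l) j, poch_succ _ j, poch_succ lam j,
      Nat.choose_succ_succ]
    have h1 := (poch_pos hlam j).ne'
    have h2 : lam + j ≠ 0 := by positivity
    have h3 : ((l.choose (j + 1) : ℕ) : ℝ) * (j + 1) = (l.choose j : ℝ) * ((l : ℝ) - j) := by
      rcases le_or_gt j l with h | h
      · have := Nat.choose_succ_right_eq l j
        rw [← Nat.cast_sub h]; exact_mod_cast this
      · rw [Nat.choose_eq_zero_of_lt h, Nat.choose_eq_zero_of_lt (by omega)]; simp
    push_cast
    field_simp
    linear_combination ((l + m + 1) * poch (lam + m + l + 1) j) * h3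
  rw [normJacobi_eq_sum lam m l w (N := l + 2) (by omega),
    normJacobi_eq_sum lam m (l + 1) w (N := l + 2) (by omega)]
  have e : (1 + w) * normJacobi lam (m + 1) l w =
      (∑ j ∈ Finset.range (l + 1),
        ((l.choose (j + 1) : ℝ) * poch (lam + (m + 1 : ℕ) + l) (j + 1) / poch lam (j + 1)
          + (l.choose j : ℝ) * poch (lam + (m + 1 : ℕ) + l) j / poch lam j) * w ^ (j + 1)) + 1 := by
    rw [add_mul, one_mul]
    nth_rw 1 [normJacobi_eq_sum lam (m + 1) l w (N := l + 2) (by omega)]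
    rw [Finset.sum_range_succ']
    simp only [normJacobi, Finset.mul_sum, add_mul, Finset.sum_add_distrib]
    simp only [Nat.choose_zero_right, poch_zero, pow_zero]
    have : ∀ j, w * ((l.choose j : ℝ) * poch (lam + (m + 1 : ℕ) + l) j / poch lam j * w ^ j) =
        (l.choose j : ℝ) * poch (lam + (m + 1 : ℕ) + l) j / poch lam j * w ^ (j + 1) := by
      intro j; ring
    simp only [this]
    push_cast
    ring
  rw [e, Finset.sum_range_succ' _ (l + 1), Finset.sum_range_succ' _ (l + 1)]
  have hs : (2 * l + lam + m + 1) * ∑ j ∈ Finset.range (l + 1),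
        ((l.choose (j + 1) : ℝ) * poch (lam + (m + 1 : ℕ) + l) (j + 1) / poch lam (j + 1)
          + (l.choose j : ℝ) * poch (lam + (m + 1 : ℕ) + l) j / poch lam j) * w ^ (j + 1) =
      (l + lam) * ∑ j ∈ Finset.range (l + 1),
        ((l + 1).choose (j + 1) : ℝ) * poch (lam + m + (l + 1 : ℕ)) (j + 1)
          / poch lam (j + 1) * w ^ (j + 1)
      + (l + m + 1) * ∑ j ∈ Finset.range (l + 1),
        (l.choose (j + 1) : ℝ) * poch (lam + m + l) (j + 1) / poch lam (j + 1) * w ^ (j + 1) := by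
    rw [Finset.mul_sum, Finset.mul_sum, Finset.mul_sum, ← Finset.sum_add_distrib]
    refine Finset.sum_congr rfl fun j _ => ?_
    linear_combination w ^ (j + 1) * key j
  simp only [Nat.choose_zero_right, poch_zero, pow_zero]
  push_cast at hs ⊢
  linear_combination hs

/-! ### Gegenbauer polynomials -/

lemma eval_gegenbauer_rec (lam : ℝ) (k : ℕ) (t : ℝ) :
    (k + 2) * (gegenbauer lam (k + 2)).eval t =
      2 * (k + 1 + lam) * t * (gegenbauer lam (k + 1)).eval t
        - (k + 2 * lam) * (gegenbauer lam k).eval t := by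
  have : (k : ℝ) + 2 ≠ 0 := by positivity
  simp only [gegenbauer, eval_sub, eval_mul, eval_C, eval_X]
  field_simp

lemma eval_derivative_gegenbauer_rec (lam : ℝ) (k : ℕ) (t : ℝ) :
    (k + 2) * (derivative (gegenbauer lam (k + 2))).eval t =
      2 * (k + 1 + lam) * ((gegenbauer lam (k + 1)).eval t
        + t * (derivative (gegenbauer lam (k + 1))).eval t)
        - (k + 2 * lam) * (derivative (gegenbauer lam k)).eval t := by
  have : (k : ℝ) + 2 ≠ 0 := by positivity
  simp only [gegenbauer, derivative_sub, derivative_mul, derivative_C, derivative_X, eval_sub,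
    eval_mul, eval_add, eval_C, eval_X, eval_zero, eval_one]
  field_simp
  ring

/-- The two identities feed each other: the differentiated recurrence and the first one at `k` give
the second at `k + 1`, which then gives the first at `k + 1`. -/
lemma eval_derivative_gegenbauer (lam : ℝ) (k : ℕ) (t : ℝ) :
    t * (derivative (gegenbauer lam (k + 1))).eval t - (derivative (gegenbauer lam k)).eval t =
        (k + 1) * (gegenbauer lam (k + 1)).eval t ∧
      (derivative (gegenbauer lam (k + 1))).eval t - t * (derivative (gegenbauer lam k)).eval t =
        (k + 2 * lam) * (gegenbauer lam k).eval t := by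
  induction k with
  | zero => simp [gegenbauer]; ring
  | succ k ih =>
    obtain ⟨h1, h2⟩ := ih
    have hr := eval_gegenbauer_rec lam k t
    have hd := eval_derivative_gegenbauer_rec lam k t
    have hk : (k : ℝ) + 2 ≠ 0 := by positivity
    have h3 : (derivative (gegenbauer lam (k + 2))).eval t
        - t * (derivative (gegenbauer lam (k + 1))).eval t =
        (k + 1 + 2 * lam) * (gegenbauer lam (k + 1)).eval t := by
      apply mul_left_cancel₀ hk
      linear_combination hd + (k + 2 * lam) * h1
    push_cast
    refine ⟨?_, h3⟩
    linear_combination t * h3 - hr - h2 + t * h1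

lemma one_sub_sq_mul_derivative_gegenbauer (lam : ℝ) (k : ℕ) (t : ℝ) :
    (1 - t ^ 2) * (derivative (gegenbauer lam k)).eval t =
      (k + 2 * lam) * t * (gegenbauer lam k).eval t
        - (k + 1) * (gegenbauer lam (k + 1)).eval t := by
  obtain ⟨h1, h2⟩ := eval_derivative_gegenbauer lam k t
  linear_combination t * h2 - h1

/-- Differentiate the first-order relation `one_sub_sq_mul_derivative_gegenbauer` and remove the
derivative of `C_{k+1}` by the second identity of `eval_derivative_gegenbauer`. -/
lemma gegenbauer_ode (lam : ℝ) (k : ℕ) (t : ℝ) :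
    (1 - t ^ 2) * (derivative (derivative (gegenbauer lam k))).eval t
        - (2 * lam + 1) * t * (derivative (gegenbauer lam k)).eval t =
      -(k * (k + 2 * lam)) * (gegenbauer lam k).eval t := by
  have h : (1 - X ^ 2) * derivative (gegenbauer lam k) =
      C (k + 2 * lam) * X * gegenbauer lam k - C ((k : ℝ) + 1) * gegenbauer lam (k + 1) := by
    apply Polynomial.funext
    intro r
    simpa using one_sub_sq_mul_derivative_gegenbauer lam k r
  have h' := congrArg (fun p => (derivative p).eval t) h
  simp only [derivative_sub, derivative_mul, derivative_C, derivative_X, eval_sub,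
    eval_mul, eval_add, eval_C, eval_X, eval_zero, eval_one, derivative_one, derivative_X_pow,
    eval_pow] at h'
  obtain ⟨h1, h2⟩ := eval_derivative_gegenbauer lam k t
  push_cast at h'
  linear_combination h' - (k + 1) * h2

lemma gegenbauer_eval_one_succ (lam : ℝ) (k : ℕ) :
    (k + 1) * (gegenbauer lam (k + 1)).eval 1 = (k + 2 * lam) * (gegenbauer lam k).eval 1 := by
  have := one_sub_sq_mul_derivative_gegenbauer lam k 1
  linear_combination this

lemma gegenbauer_eval_one_pos {lam : ℝ} (hlam : 0 < lam) (k : ℕ) :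
    0 < (gegenbauer lam k).eval 1 := by
  induction k with
  | zero => simp [gegenbauer]
  | succ k ih =>
    have h := gegenbauer_eval_one_succ lam k
    have : 0 < (k + 2 * lam) * (gegenbauer lam k).eval 1 := by positivity
    rw [← h] at this
    exact pos_of_mul_pos_right this (by positivity)

lemma gegenbauer_degree {lam : ℝ} (hlam : 0 < lam) (k : ℕ) :
    ((gegenbauer lam k).natDegree ≤ k ∧ 0 < (gegenbauer lam k).coeff k) ∧
      ((gegenbauer lam (k + 1)).natDegree ≤ k + 1 ∧ 0 < (gegenbauer lam (k + 1)).coeff (k + 1)) := by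
  induction k with
  | zero =>
    refine ⟨by simp [gegenbauer], ?_, ?_⟩
    · simp only [gegenbauer]; compute_degree
    · simp [gegenbauer, hlam]
  | succ k ih =>
    refine ⟨ih.2, ?_, ?_⟩
    · simp only [gegenbauer]
      refine (natDegree_sub_le _ _).trans (max_le ?_ ?_)
      · refine natDegree_mul_le.trans ?_
        have := (natDegree_C_mul_le (2 * ((k : ℝ) + 1 + lam) / ((k : ℝ) + 2)) X).trans natDegree_X_le
        have := ih.2.1
        omega
      · refine (natDegree_C_mul_le _ _).trans ?_
        have := ih.1.1
        omega
    · simp only [gegenbauer]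
      rw [coeff_sub, mul_assoc, coeff_C_mul, coeff_C_mul, coeff_X_mul,
        coeff_eq_zero_of_natDegree_lt (p := gegenbauer lam k) (by have := ih.1.1; omega)]
      have := ih.2.2
      simp only [mul_zero, sub_zero]
      positivity

lemma X_mul_gegenbauer_zero (lam : ℝ) :
    C (2 * lam) * (X * gegenbauer lam 0) = gegenbauer lam 1 := by
  simp [gegenbauer]

lemma X_mul_gegenbauer_succ (lam : ℝ) (k : ℕ) :
    C (2 * (k + 1 + lam)) * (X * gegenbauer lam (k + 1)) =
      C ((k : ℝ) + 2) * gegenbauer lam (k + 2) + C (k + 2 * lam) * gegenbauer lam k := by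
  apply Polynomial.funext
  intro r
  have := eval_gegenbauer_rec lam k r
  simp only [eval_add, eval_mul, eval_C, eval_X]
  linear_combination -this

/-- Integration of polynomials against `(1 - s²)^μ` on `[-1, 1]`. -/
noncomputable def gegenbauerInt (μ : ℝ) (hμ : 0 ≤ μ) : ℝ[X] →ₗ[ℝ] ℝ where
  toFun q := ∫ s in (-1 : ℝ)..1, q.eval s * (1 - s ^ 2) ^ μ
  map_add' p q := by
    have h (q : ℝ[X]) : Continuous fun s : ℝ => q.eval s * (1 - s ^ 2) ^ μ :=
      q.continuous.mul ((by fun_prop : Continuous fun s : ℝ => 1 - s ^ 2).rpow_const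
        fun _ => Or.inr hμ)
    simp only [eval_add, add_mul]
    exact intervalIntegral.integral_add ((h p).intervalIntegrable _ _)
      ((h q).intervalIntegrable _ _)
  map_smul' c q := by
    simp only [eval_smul, smul_eq_mul, mul_assoc, RingHom.id_apply]
    exact intervalIntegral.integral_const_mul _ _

/-- The integrand is the derivative of `(1 - s²)^(μ+1) q`, which vanishes at both ends. As `2μ + 2 =
2 lam + 1`, the choice `q = C_k'` gives the left side of the Gegenbauer equation. -/
lemma gegenbauerInt_byParts {μ : ℝ} (hμ : 0 ≤ μ) (q : ℝ[X]) :
    gegenbauerInt μ hμ ((1 - X ^ 2) * derivative q - C (2 * μ + 2) * X * q) = 0 := by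
  have hd : ∀ x ∈ Set.Ioo (-1 : ℝ) 1, HasDerivAt (fun s => (1 - s ^ 2) ^ (μ + 1) * q.eval s)
      (((1 - X ^ 2) * derivative q - C (2 * μ + 2) * X * q).eval x * (1 - x ^ 2) ^ μ) x := by
    intro x hx
    have h1 : HasDerivAt (fun s : ℝ => 1 - s ^ 2) (-(2 * x)) x := by
      simpa using (hasDerivAt_pow 2 x).const_sub 1
    have h2 := (h1.rpow_const (p := μ + 1) (Or.inr (by linarith))).mul (q.hasDerivAt x)
    refine h2.congr_deriv ?_
    have h3 : 0 < 1 - x ^ 2 := by nlinarith [hx.1, hx.2]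
    have h4 : (1 - x ^ 2) ^ (μ + 1) = (1 - x ^ 2) ^ μ * (1 - x ^ 2) := by
      rw [Real.rpow_add h3, Real.rpow_one]
    rw [h4, add_sub_cancel_right]
    simp only [eval_sub, eval_mul, eval_C, eval_X, eval_one, eval_pow]
    ring
  have hc : Continuous fun s : ℝ => (1 - s ^ 2) ^ (μ + 1) * q.eval s :=
    ((by fun_prop : Continuous fun s : ℝ => 1 - s ^ 2).rpow_const
      fun _ => Or.inr (by linarith)).mul q.continuous
  have hi : Continuous fun s : ℝ =>
      (((1 - X ^ 2) * derivative q - C (2 * μ + 2) * X * q).eval s * (1 - s ^ 2) ^ μ) :=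
    (Polynomial.continuous _).mul ((by fun_prop : Continuous fun s : ℝ => 1 - s ^ 2).rpow_const
      fun _ => Or.inr hμ)
  have := intervalIntegral.integral_eq_sub_of_hasDerivAt_of_le (by norm_num) hc.continuousOn hd
    (hi.intervalIntegrable _ _)
  simp only [one_pow, even_two, Even.neg_pow, sub_self] at this
  rw [Real.zero_rpow (by linarith)] at this
  simpa [gegenbauerInt] using this

lemma gegenbauerInt_C_mul {μ : ℝ} (hμ : 0 ≤ μ) (c : ℝ) (q : ℝ[X]) :
    gegenbauerInt μ hμ (C c * q) = c * gegenbauerInt μ hμ q := by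
  rw [← smul_eq_C_mul, map_smul, smul_eq_mul]

lemma gegenbauerInt_gegenbauer {μ : ℝ} (hμ : 0 ≤ μ) {k : ℕ} (hk : k ≠ 0) :
    gegenbauerInt μ hμ (gegenbauer (μ + 1 / 2) k) = 0 := by
  have h : (1 - X ^ 2) * derivative (derivative (gegenbauer (μ + 1 / 2) k))
      - C (2 * μ + 2) * X * derivative (gegenbauer (μ + 1 / 2) k) =
      C (-(k * (k + 2 * (μ + 1 / 2)))) * gegenbauer (μ + 1 / 2) k := by
    apply Polynomial.funext
    intro r
    have := gegenbauer_ode (μ + 1 / 2) k r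
    simp only [eval_sub, eval_mul, eval_C, eval_X, eval_one, eval_pow]
    linear_combination this
  have h' := gegenbauerInt_byParts hμ (derivative (gegenbauer (μ + 1 / 2) k))
  rw [h, gegenbauerInt_C_mul] at h'
  refine (mul_eq_zero.mp h').resolve_left (neg_ne_zero.mpr ?_)
  have : (0 : ℝ) < k := by exact_mod_cast Nat.pos_of_ne_zero hk
  positivity

/-- One factor `X` is absorbed by the three-term recurrence, which moves the index `k` by one only,
so it stays above the remaining power. -/
lemma gegenbauerInt_mul_X_pow {μ : ℝ} (hμ : 0 ≤ μ) {k i : ℕ} (hik : i < k) :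
    gegenbauerInt μ hμ (gegenbauer (μ + 1 / 2) k * X ^ i) = 0 := by
  induction i generalizing k with
  | zero => simpa using gegenbauerInt_gegenbauer hμ (by omega)
  | succ i ih =>
    obtain ⟨k, rfl⟩ : ∃ k', k = k' + 1 := ⟨k - 1, by omega⟩
    have h := congrArg (fun p => gegenbauerInt μ hμ (p * X ^ i))
      (X_mul_gegenbauer_succ (μ + 1 / 2) k)
    beta_reduce at h
    rw [mul_assoc, gegenbauerInt_C_mul, add_mul, map_add, mul_assoc (C _), mul_assoc (C _),
      gegenbauerInt_C_mul, gegenbauerInt_C_mul, ih (by omega), ih (by omega), mul_zero, mul_zero,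
      add_zero] at h
    have h' := (mul_eq_zero.mp h).resolve_left (by positivity)
    rw [← h', pow_succ]
    congr 1
    ring

lemma gegenbauerInt_mul_eq_zero {μ : ℝ} (hμ : 0 ≤ μ) {k : ℕ} {q : ℝ[X]} (hq : q.natDegree < k) :
    gegenbauerInt μ hμ (gegenbauer (μ + 1 / 2) k * q) = 0 := by
  rw [q.as_sum_range' k hq, Finset.mul_sum, map_sum]
  refine Finset.sum_eq_zero fun i hi => ?_
  rw [← C_mul_X_pow_eq_monomial, mul_left_comm, gegenbauerInt_C_mul,
    gegenbauerInt_mul_X_pow hμ (Finset.mem_range.mp hi), mul_zero]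

lemma gegenbauerInt_mul_gegenbauer {μ : ℝ} (hμ : 0 ≤ μ) {j k : ℕ} (hjk : j ≠ k) :
    gegenbauerInt μ hμ (gegenbauer (μ + 1 / 2) j * gegenbauer (μ + 1 / 2) k) = 0 := by
  have hlam : 0 < μ + 1 / 2 := by linarith
  rcases lt_or_gt_of_ne hjk with h | h
  · rw [mul_comm]
    exact gegenbauerInt_mul_eq_zero hμ ((gegenbauer_degree hlam j).1.1.trans_lt h)
  · exact gegenbauerInt_mul_eq_zero hμ ((gegenbauer_degree hlam k).1.1.trans_lt h)

/-- Evaluating the integral of `X C_k C_{k+1}` in two ways, expanding `X C_k` or `X C_{k+1}`, gives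
the ratio of consecutive norms. The values at 1 obey a matching recurrence. -/
lemma gegenbauerInt_gegenbauer_sq {μ : ℝ} (hμ : 0 ≤ μ) (k : ℕ) :
    (k + μ + 1 / 2) * gegenbauerInt μ hμ (gegenbauer (μ + 1 / 2) k * gegenbauer (μ + 1 / 2) k) =
      (μ + 1 / 2) * gegenbauerInt μ hμ 1 * (gegenbauer (μ + 1 / 2) k).eval 1 := by
  induction k with
  | zero => simp [gegenbauer]
  | succ k ih =>
    set G := gegenbauer (μ + 1 / 2) with hG
    set L := gegenbauerInt μ hμ with hL
    have h1 : 2 * (k + (μ + 1 / 2)) * L (X * G k * G (k + 1)) = (k + 1) * L (G (k + 1) * G (k + 1)) := by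
      rcases k with _ | k
      · have h := congrArg (fun p => L (p * G 1)) (X_mul_gegenbauer_zero (μ + 1 / 2))
        simp only [mul_assoc, hL, gegenbauerInt_C_mul] at h
        simp only [mul_assoc, hL]
        simp only [zero_add, Nat.cast_zero]
        linear_combination h
      · have h := congrArg (fun p => L (p * G (k + 2))) (X_mul_gegenbauer_succ (μ + 1 / 2) k)
        simp only [add_mul, map_add, mul_assoc, hL, gegenbauerInt_C_mul] at h
        rw [gegenbauerInt_mul_gegenbauer hμ (j := k) (k := k + 2) (by omega)] at h
        simp only [mul_assoc, hL]
        push_cast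
        linear_combination h
    have h2 : 2 * (k + 1 + (μ + 1 / 2)) * L (X * G k * G (k + 1)) =
        (k + 2 * (μ + 1 / 2)) * L (G k * G k) := by
      have h := congrArg (fun p => L (p * G k)) (X_mul_gegenbauer_succ (μ + 1 / 2) k)
      simp only [add_mul, map_add, mul_assoc, hL, gegenbauerInt_C_mul] at h
      rw [gegenbauerInt_mul_gegenbauer hμ (j := k + 2) (k := k) (by omega)] at h
      have e : X * G k * G (k + 1) = X * (G (k + 1) * G k) := by ring
      rw [e]
      linear_combination h
    have h3 := gegenbauer_eval_one_succ (μ + 1 / 2) k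
    have hk : (k : ℝ) + 1 ≠ 0 := by positivity
    apply mul_left_cancel₀ hk
    push_cast
    linear_combination (-(k + 1 + μ + 1 / 2)) * h1 + (k + (μ + 1 / 2)) * h2
      + (k + 2 * (μ + 1 / 2)) * ih - (μ + 1 / 2) * L 1 * h3

/-! ### The interpolatory quadrature -/

lemma quasiOrthogonal_degree {μ : ℝ} (hμ : 0 ≤ μ) (a : ℝ) (n : ℕ) :
    quasiOrthogonal μ a n ≠ 0 ∧ (quasiOrthogonal μ a n).natDegree = n + 1 := by
  obtain ⟨⟨h1, -⟩, h2, h3⟩ := gegenbauer_degree (by linarith : 0 < μ + 1 / 2) n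
  have hc : (quasiOrthogonal μ a n).coeff (n + 1) ≠ 0 := by
    unfold quasiOrthogonal
    rw [coeff_add, coeff_C_mul, coeff_eq_zero_of_natDegree_lt (p := gegenbauer _ n) (by omega), mul_zero, add_zero]
    exact h3.ne'
  refine ⟨fun h => hc (by simp [h]), le_antisymm ?_ (le_natDegree_of_ne_zero hc)⟩
  unfold quasiOrthogonal
  refine (natDegree_add_le _ _).trans (max_le h2 ((natDegree_C_mul_le _ _).trans (by omega)))

lemma quadrature_exact_of_natDegree_le {μ : ℝ} (hμ : 0 ≤ μ) {n : ℕ} {t : Fin (n + 1) → ℝ}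
    (ht : Function.Injective t) {r : ℝ[X]} (hr : r.degree < (n + 1 : ℕ)) :
    ∑ j, quadWeight μ t j * r.eval (t j) = gegenbauerInt μ hμ r := by
  have h := Lagrange.eq_interpolate (s := Finset.univ) (v := t) ht.injOn (f := r) (by simpa using hr)
  conv_rhs => rw [h, Lagrange.interpolate_apply, map_sum]
  refine Finset.sum_congr rfl fun j _ => ?_
  rw [gegenbauerInt_C_mul, mul_comm]
  rfl

/-- The quadrature at the zeros of a quasi-orthogonal polynomial is exact in degree `2n`. -/
lemma quadrature_exact {μ : ℝ} (hμ : 0 ≤ μ) {n : ℕ} {a : ℝ} {t : Fin (n + 1) → ℝ}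
    (ht : Function.Injective t) (hz : ∀ j, (quasiOrthogonal μ a n).IsRoot (t j)) {q : ℝ[X]}
    (hq : q.natDegree ≤ 2 * n) :
    ∑ j, quadWeight μ t j * q.eval (t j) = gegenbauerInt μ hμ q := by
  obtain ⟨h0, hdeg⟩ := quasiOrthogonal_degree hμ a n
  set W := quasiOrthogonal μ a n with hW
  have hdiv := EuclideanDomain.div_add_mod q W
  have hr : (q % W).degree < (n + 1 : ℕ) := by
    have := degree_mod_lt q h0
    rwa [degree_eq_natDegree h0, hdeg] at this
  -- A nonzero quotient has degree at most `n - 1`, so it is orthogonal to both `C_{n+1}` and `C_n`.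
  -- The term `a C_n` is what limits exactness to degree `2n`.
  have hg : gegenbauerInt μ hμ (W * (q / W)) = 0 := by
    by_cases hqW : q / W = 0
    · simp [hqW]
    · have hle : W.degree ≤ q.degree := by
        by_contra h
        exact hqW ((Polynomial.div_eq_zero_iff h0).mpr (not_le.mp h))
      have hadd := degree_add_div h0 hle
      have hq0 : q ≠ 0 := by
        rintro rfl
        simp at hqW
      rw [degree_eq_natDegree h0, degree_eq_natDegree hqW, degree_eq_natDegree hq0, hdeg] at hadd
      have hadd' : n + 1 + (q / W).natDegree = q.natDegree := by exact_mod_cast hadd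
      rw [hW, quasiOrthogonal, add_mul, map_add, mul_assoc, gegenbauerInt_C_mul,
        gegenbauerInt_mul_eq_zero hμ (by rw [← quasiOrthogonal, ← hW]; omega),
        gegenbauerInt_mul_eq_zero hμ (by rw [← quasiOrthogonal, ← hW]; omega)]
      simp
  have hev : ∀ j, q.eval (t j) = (q % W).eval (t j) := fun j => by
    have h : W.eval (t j) = 0 := hz j
    conv_lhs => rw [← hdiv]
    simp [h]
  simp only [hev]
  rw [quadrature_exact_of_natDegree_le hμ ht hr]
  conv_rhs => rw [← hdiv, map_add, hg, zero_add]

/-! ### The norms of the Jacobi polynomials -/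

lemma intervalIntegrable_jacobiWeight {lam : ℝ} (hlam : 0 < lam) (m : ℕ) :
    IntervalIntegrable (jacobiWeight (lam - 1) m) MeasureTheory.volume (-1) 1 := by
  unfold jacobiWeight
  simp only [Real.rpow_natCast]
  refine IntervalIntegrable.mul_continuousOn ?_ (by fun_prop)
  have h := (intervalIntegral.intervalIntegrable_rpow' (a := 0) (b := 2)
    (by linarith : -1 < lam - 1)).comp_sub_left 1
  norm_num at h
  exact h.symm

/-- Integration against the Jacobi weight `(1 - t)^(lam - 1) (1 + t)^m` of a function of the
variable `(t - 1) / 2`. -/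
noncomputable def jacobiInt (lam : ℝ) (m : ℕ) (f : ℝ → ℝ) : ℝ :=
  ∫ t in (-1 : ℝ)..1, f ((t - 1) / 2) * jacobiWeight (lam - 1) m t

lemma intervalIntegrable_mul_jacobiWeight {lam : ℝ} (hlam : 0 < lam) (m : ℕ) {f : ℝ → ℝ}
    (hf : Continuous f) :
    IntervalIntegrable (fun t => f ((t - 1) / 2) * jacobiWeight (lam - 1) m t)
      MeasureTheory.volume (-1) 1 :=
  (intervalIntegrable_jacobiWeight hlam m).continuousOn_mul (by fun_prop)

lemma jacobiInt_const_mul (lam : ℝ) (m : ℕ) (c : ℝ) (f : ℝ → ℝ) :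
    jacobiInt lam m (fun w => c * f w) = c * jacobiInt lam m f := by
  unfold jacobiInt
  simp only [mul_assoc]
  exact intervalIntegral.integral_const_mul _ _

lemma jacobiInt_linear {lam : ℝ} (hlam : 0 < lam) (m : ℕ) {f g h : ℝ → ℝ}
    (hg : Continuous g) (hh : Continuous h) {a b c : ℝ}
    (H : ∀ w, a * f w = b * g w + c * h w) :
    a * jacobiInt lam m f = b * jacobiInt lam m g + c * jacobiInt lam m h := by
  simp only [← jacobiInt_const_mul, H]
  unfold jacobiInt
  simp only [add_mul]
  exact intervalIntegral.integral_add
    (intervalIntegrable_mul_jacobiWeight hlam m (hg.const_mul b))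
    (intervalIntegrable_mul_jacobiWeight hlam m (hh.const_mul c))

lemma jacobiInt_succ (lam : ℝ) (m : ℕ) (f : ℝ → ℝ) :
    jacobiInt lam (m + 1) f = 2 * jacobiInt lam m (fun w => (1 + w) * f w) := by
  rw [← jacobiInt_const_mul]
  unfold jacobiInt jacobiWeight
  simp only [Real.rpow_natCast, pow_succ]
  congr 1
  ext t
  ring

/-- Integrate the derivative of `(1 - s)^lam (1 + s)^(m+1)`, which vanishes at both ends. -/
lemma jacobiInt_one_succ {lam : ℝ} (hlam : 0 < lam) (m : ℕ) :
    (lam + m + 1) * jacobiInt lam (m + 1) (fun _ => 1) =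
      2 * (m + 1) * jacobiInt lam m (fun _ => 1) := by
  have hd : ∀ x ∈ Set.Ioo (-1 : ℝ) 1,
      HasDerivAt (fun s : ℝ => (1 - s) ^ lam * (1 + s) ^ (m + 1))
        ((2 * (m + 1) - 2 * (lam + m + 1) * (1 + (x - 1) / 2)) * jacobiWeight (lam - 1) m x) x := by
    intro x hx
    have h0 : 0 < 1 - x := by linarith [hx.2]
    have h1 : HasDerivAt (fun s : ℝ => 1 - s) (-1) x := by
      simpa using (hasDerivAt_id x).const_sub 1
    have h2 := h1.rpow_const (p := lam) (Or.inl h0.ne')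
    have h3 : HasDerivAt (fun s : ℝ => (1 + s) ^ (m + 1)) (((m + 1 : ℕ) : ℝ) * (1 + x) ^ m * 1) x := by
      simpa using ((hasDerivAt_id x).const_add 1).fun_pow (m + 1)
    refine (h2.mul h3).congr_deriv ?_
    have h4 : (1 - x) ^ lam = (1 - x) ^ (lam - 1) * (1 - x) := by
      rw [← Real.rpow_add_one h0.ne', sub_add_cancel]
    rw [h4, jacobiWeight, Real.rpow_natCast]
    push_cast
    ring
  have hc : Continuous fun s : ℝ => (1 - s) ^ lam * (1 + s) ^ (m + 1) :=
    ((by fun_prop : Continuous fun s : ℝ => 1 - s).rpow_const fun _ => Or.inr hlam.le).mul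
      (by fun_prop)
  have h := intervalIntegral.integral_eq_sub_of_hasDerivAt_of_le (by norm_num) hc.continuousOn hd
    (intervalIntegrable_mul_jacobiWeight hlam m
      (f := fun w => 2 * (m + 1) - 2 * (lam + m + 1) * (1 + w)) (by fun_prop))
  have h0 : (0 : ℝ) ^ lam = 0 := Real.zero_rpow hlam.ne'
  norm_num [h0] at h
  have h' := jacobiInt_linear hlam m (f := fun w => 2 * (m + 1) - 2 * (lam + m + 1) * (1 + w))
    (g := fun _ => 1) (h := fun w => (1 + w) * 1) (a := 1) (b := 2 * (m + 1))
    (c := -(2 * (lam + m + 1))) (by fun_prop) (by fun_prop) (fun w => by ring)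
  have h'' : jacobiInt lam m (fun w => 2 * (m + 1) - 2 * (lam + m + 1) * (1 + w)) = 0 := h
  rw [h''] at h'
  rw [jacobiInt_succ]
  linear_combination h'

lemma jacobiInt_one_pos {lam : ℝ} (hlam : 0 < lam) (m : ℕ) :
    0 < jacobiInt lam m (fun _ => 1) := by
  unfold jacobiInt
  refine intervalIntegral.intervalIntegral_pos_of_pos_on
    (intervalIntegrable_mul_jacobiWeight hlam m continuous_const) (fun x hx => ?_) (by norm_num)
  have h1 : 0 < 1 - x := by linarith [hx.2]
  have h2 : 0 < 1 + x := by linarith [hx.1]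
  unfold jacobiWeight
  positivity

lemma jacobiInt_normJacobi_lower {lam : ℝ} (hlam : 0 < lam) (m l : ℕ) {f : ℝ → ℝ}
    (hf : Continuous f) :
    (l + lam) * jacobiInt lam m (fun w => normJacobi lam m (l + 1) w * f w)
        + (l + m + 1) * jacobiInt lam m (fun w => normJacobi lam m l w * f w) =
      (2 * l + lam + m + 1) / 2 *
        jacobiInt lam (m + 1) (fun w => normJacobi lam (m + 1) l w * f w) := by
  have h1 := continuous_normJacobi lam m (l + 1)
  have h2 := continuous_normJacobi lam m l
  rw [jacobiInt_succ, ← jacobiInt_linear hlam m (a := 2 * l + lam + m + 1)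
    (f := fun w => (1 + w) * (normJacobi lam (m + 1) l w * f w)) (by fun_prop) (by fun_prop)
    fun w => by linear_combination f w * normJacobi_lower hlam m l w]
  ring

lemma jacobiInt_normJacobi_raise {lam : ℝ} (hlam : 0 < lam) (m j : ℕ) {f : ℝ → ℝ}
    (hf : Continuous f) :
    (2 * j + lam + m) * jacobiInt lam (m + 1) (fun w => f w * normJacobi lam m j w) =
      (j + lam + m) * jacobiInt lam (m + 1) (fun w => f w * normJacobi lam (m + 1) j w)
        + j * jacobiInt lam (m + 1) (fun w => f w * normJacobi lam (m + 1) (j - 1) w) := by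
  have h1 := continuous_normJacobi lam (m + 1) j
  have h2 := continuous_normJacobi lam (m + 1) (j - 1)
  exact jacobiInt_linear hlam (m + 1) (by fun_prop) (by fun_prop)
    fun w => by linear_combination f w * normJacobi_raise (lam := lam) m j w

/-- The square of the norm of the normalized Jacobi polynomial. -/
noncomputable def jacobiNormSq (lam : ℝ) (m l : ℕ) : ℝ :=
  jacobiInt lam m (fun w => normJacobi lam m l w * normJacobi lam m l w)

/-- Both sides come from one pairing, that of the polynomials `(m+1, l)` and `(m, l+1)` for the
weight `m + 1`, computed by the lowering and by the raising relation. Orthogonality is a hypothesis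
so that the lemma can serve inside the induction that proves it. -/
lemma jacobiNormSq_succ_of_orthogonal {lam : ℝ} (hlam : 0 < lam) (l : ℕ)
    (H : ∀ m, jacobiInt lam m
      (fun w => normJacobi lam m (l + 1) w * normJacobi lam m l w) = 0) (m : ℕ) :
    2 * (l + lam) * (2 * l + 2 + lam + m) * jacobiNormSq lam m (l + 1) =
      (2 * l + lam + m + 1) * (l + 1) * jacobiNormSq lam (m + 1) l := by
  have hA := jacobiInt_normJacobi_lower hlam m l (continuous_normJacobi lam m (l + 1))
  have hB := jacobiInt_normJacobi_raise hlam m (l + 1) (continuous_normJacobi lam (m + 1) l)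
  have c1 : (fun w => normJacobi lam m l w * normJacobi lam m (l + 1) w) =
      fun w => normJacobi lam m (l + 1) w * normJacobi lam m l w := by ext; ring
  have c2 : (fun w => normJacobi lam (m + 1) l w * normJacobi lam (m + 1) (l + 1) w) =
      fun w => normJacobi lam (m + 1) (l + 1) w * normJacobi lam (m + 1) l w := by ext; ring
  rw [c1, H] at hA
  rw [c2, H, Nat.add_sub_cancel] at hB
  unfold jacobiNormSq
  push_cast at hB
  linear_combination 2 * (2 * l + 2 + lam + m) * hA + (2 * l + lam + m + 1) * hB

/-- Orthogonality and the ratio of the norms for `m` and `m + 1` are proved together by induction on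
`l`, for all `m`. Lowering one factor and raising the other reduces a pairing at `l + 1` to pairings
at `l`. -/
lemma jacobi_orthogonal {lam : ℝ} (hlam : 0 < lam) (l : ℕ) :
    ∀ m : ℕ, (∀ j < l, jacobiInt lam m
        (fun w => normJacobi lam m l w * normJacobi lam m j w) = 0) ∧
      (l + m + lam) * (2 * l + m + 1 + lam) * jacobiNormSq lam (m + 1) l =
        2 * (l + m + 1) * (2 * l + m + lam) * jacobiNormSq lam m l := by
  induction l with
  | zero =>
    intro m
    refine ⟨by simp, ?_⟩
    simp only [jacobiNormSq, normJacobi_zero, mul_one, Nat.cast_zero]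
    linear_combination (m + lam) * jacobiInt_one_succ hlam m
  | succ l ih =>
    have horth : ∀ m : ℕ, ∀ j < l + 1, jacobiInt lam m
        (fun w => normJacobi lam m (l + 1) w * normJacobi lam m j w) = 0 := by
      intro m j hj
      have hA := jacobiInt_normJacobi_lower hlam m l (continuous_normJacobi lam m j)
      have hB := jacobiInt_normJacobi_raise hlam m j (continuous_normJacobi lam (m + 1) l)
      have hpos : (0 : ℝ) < 2 * j + lam + m := by positivity
      have hpos' : (0 : ℝ) < l + lam := by positivity
      have hB2 : (j : ℝ) * jacobiInt lam (m + 1)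
          (fun w => normJacobi lam (m + 1) l w * normJacobi lam (m + 1) (j - 1) w) = 0 := by
        rcases Nat.eq_zero_or_pos j with rfl | h
        · simp
        · rw [(ih (m + 1)).1 _ (by omega), mul_zero]
      rw [hB2, add_zero] at hB
      rcases Nat.lt_succ_iff_lt_or_eq.mp hj with h | rfl
      · rw [(ih (m + 1)).1 j h, mul_zero] at hB
        rw [(ih m).1 j h, (mul_eq_zero.mp hB).resolve_left hpos.ne', mul_zero, mul_zero,
          add_zero] at hA
        exact (mul_eq_zero.mp hA).resolve_left hpos'.ne'
      -- For neighbouring degrees two norms survive, with weights `m` and `m + 1`; the ratio from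
      -- the induction hypothesis makes them cancel.
      · have hR := (ih m).2
        unfold jacobiNormSq at hR
        refine (mul_eq_zero.mp (?_ : ((2 * j + lam + m) * (j + lam)) * _ = 0)).resolve_left
          (by positivity)
        linear_combination (2 * j + lam + m) * hA + (2 * j + lam + m + 1) / 2 * hB + hR / 2
    intro m
    refine ⟨horth m, ?_⟩
    -- The norms of degree `l + 1` for `m` and `m + 1` are expressed by those of degree `l` for `m +
    -- 1` and `m + 2`, whose ratio is known.
    have hK := jacobiNormSq_succ_of_orthogonal hlam l fun m => horth m l (Nat.lt_succ_self l)
    have h1 := hK m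
    have h2 := hK (m + 1)
    have h3 := (ih (m + 1)).2
    have hl : (2 * (l + lam) : ℝ) ≠ 0 := by positivity
    apply mul_left_cancel₀ hl
    push_cast at h1 h2 h3 ⊢
    linear_combination (l + 1 + m + lam) * h2 + (l + 1) * h3 - 2 * (l + m + 2) * h1

lemma jacobiNormSq_succ {lam : ℝ} (hlam : 0 < lam) (m l : ℕ) :
    2 * (l + lam) * (2 * l + 2 + lam + m) * jacobiNormSq lam m (l + 1) =
      (2 * l + lam + m + 1) * (l + 1) * jacobiNormSq lam (m + 1) l :=
  jacobiNormSq_succ_of_orthogonal hlam l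
    (fun m => (jacobi_orthogonal hlam (l + 1) m).1 l (Nat.lt_succ_self l)) m

/-! ### The kernel constants and the Jacobi norms. -/

lemma HSq_pos {μ : ℝ} (hμ : 0 ≤ μ) (k l : ℕ) : 0 < HSq μ k l := by
  have h1 := poch_pos (by linarith : 0 < μ + 1 / 2) l
  have h2 := poch_pos (by linarith : 0 < μ + 3 / 2) (k - l)
  unfold HSq
  positivity

/-- Up to the total mass, the right side is the Gamma quotient in `basisConst`; this is why the
kernel constants cancel in `kernelD_eq`. The induction trades `l + 1` at `m` for `l` at `m + 1`,
which leaves `k - l` unchanged. -/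
lemma HSq_mul_jacobiNormSq {μ : ℝ} (hμ : 0 ≤ μ) (m l : ℕ) :
    HSq μ (m + 2 * l) l * jacobiNormSq (μ + 1 / 2) m l =
      poch (μ + 3 / 2) m / m.factorial * jacobiInt (μ + 1 / 2) m (fun _ => 1) := by
  have hlam : 0 < μ + 1 / 2 := by linarith
  induction l generalizing m with
  | zero =>
    have : (m : ℝ) + μ + 1 / 2 ≠ 0 := by positivity
    simp only [HSq, jacobiNormSq, normJacobi_zero, mul_one, mul_zero, add_zero, poch_zero,
      Nat.sub_zero, Nat.factorial_zero, Nat.cast_one, one_mul]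
    field_simp
  | succ l ih =>
    have h1 := jacobiNormSq_succ hlam m l
    have h2 := ih (m + 1)
    have h3 := jacobiInt_one_succ hlam m
    have e1 : m + 2 * (l + 1) - (l + 1) = m + l + 1 := by omega
    have e2 : m + 1 + 2 * l - l = m + l + 1 := by omega
    have hK : HSq μ (m + 2 * (l + 1)) (l + 1) * ((2 * l + (μ + 1 / 2) + m + 1) * (l + 1)) =
        ((μ + 1 / 2) + l) * (2 * l + 2 + (μ + 1 / 2) + m) * HSq μ (m + 1 + 2 * l) l := by
      unfold HSq
      rw [e1, e2, poch_succ (μ + 1 / 2) l, Nat.factorial_succ l]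
      have : ((m + l + 1 : ℕ) : ℝ) + μ + 1 / 2 ≠ 0 := by positivity
      have : ((m + l + 1).factorial : ℝ) ≠ 0 := by positivity
      have : (l.factorial : ℝ) ≠ 0 := by positivity
      push_cast at *
      field_simp
      ring
    have hp : (2 * (l + (μ + 1 / 2)) * (2 * l + 2 + (μ + 1 / 2) + m) : ℝ) ≠ 0 := by positivity
    apply mul_left_cancel₀ hp
    have h4 : 2 * (poch (μ + 3 / 2) (m + 1) / ((m + 1).factorial : ℝ) *
          jacobiInt (μ + 1 / 2) (m + 1) (fun _ => 1)) =
        2 * (2 * (poch (μ + 3 / 2) m / m.factorial * jacobiInt (μ + 1 / 2) m (fun _ => 1))) := by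
      rw [poch_succ, Nat.factorial_succ]
      have : (m.factorial : ℝ) ≠ 0 := by positivity
      generalize jacobiInt (μ + 1 / 2) (m + 1) (fun _ => 1) = J' at h3 ⊢
      generalize jacobiInt (μ + 1 / 2) m (fun _ => 1) = J at h3 ⊢
      generalize poch (μ + 3 / 2) m = p
      push_cast
      field_simp
      linear_combination 2 * p * h3
    linear_combination HSq μ (m + 2 * (l + 1)) (l + 1) * h1 + jacobiNormSq (μ + 1 / 2) (m + 1) l * hK
      + (l + (μ + 1 / 2)) * (2 * l + 2 + (μ + 1 / 2) + m) * h2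
      + (l + (μ + 1 / 2)) * (2 * l + 2 + (μ + 1 / 2) + m) / 2 * h4

lemma jacobiNormSq_pos {μ : ℝ} (hμ : 0 ≤ μ) (m l : ℕ) : 0 < jacobiNormSq (μ + 1 / 2) m l := by
  have h := HSq_mul_jacobiNormSq hμ m l
  have h1 := jacobiInt_one_pos (by linarith : 0 < μ + 1 / 2) m
  have h2 := poch_pos (by linarith : 0 < μ + 3 / 2) m
  have : 0 < HSq μ (m + 2 * l) l * jacobiNormSq (μ + 1 / 2) m l := by rw [h]; positivity
  exact pos_of_mul_pos_right this (HSq_pos hμ _ _).le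

lemma jacobiON_eq {lam : ℝ} (hlam : 0 < lam) (m l : ℕ) (t : ℝ) :
    jacobiON (lam - 1) m l t = normJacobi lam m l ((t - 1) / 2) /
      Real.sqrt (jacobiNormSq lam m l / jacobiInt lam m (fun _ => 1)) := by
  have hc : 0 < poch lam l / (l.factorial : ℝ) := by have := poch_pos hlam l; positivity
  set c := poch lam l / (l.factorial : ℝ) with hcdef
  have h1 : (∫ s in (-1 : ℝ)..1, jacobi (lam - 1) m l s ^ 2 * jacobiWeight (lam - 1) m s) =
      c ^ 2 * jacobiNormSq lam m l := by
    rw [jacobiNormSq, ← jacobiInt_const_mul]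
    unfold jacobiInt
    congr 1
    ext s
    rw [jacobi_eq_normJacobi hlam]
    ring
  have h2 : (∫ s in (-1 : ℝ)..1, jacobiWeight (lam - 1) m s) = jacobiInt lam m (fun _ => 1) := by
    simp [jacobiInt]
  rw [jacobiON, h1, h2, mul_div_assoc, Real.sqrt_mul (by positivity), Real.sqrt_sq hc.le,
    jacobi_eq_normJacobi hlam, mul_div_mul_left _ _ hc.ne']

/-! ### Attenuated Radon projections of the disk polynomials -/

/-- The Gegenbauer polynomial with value one at `t = 1`. -/
noncomputable def normGegenbauer (lam : ℝ) (k : ℕ) (t : ℝ) : ℝ :=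
  (gegenbauer lam k).eval t / (gegenbauer lam k).eval 1

lemma normGegenbauer_zero (lam t : ℝ) : normGegenbauer lam 0 t = 1 := by
  simp [normGegenbauer, gegenbauer]

lemma normGegenbauer_rec {lam : ℝ} (hlam : 0 < lam) (k : ℕ) (t : ℝ) :
    (k + 2 * lam) * normGegenbauer lam (k + 1) t =
      2 * (k + lam) * t * normGegenbauer lam k t - k * normGegenbauer lam (k - 1) t := by
  unfold normGegenbauer
  rcases k with _ | k
  · simp [gegenbauer]
    field_simp
    simp
  · have h1 := gegenbauer_eval_one_succ lam k
    have h2 := gegenbauer_eval_one_succ lam (k + 1)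
    have h3 := eval_gegenbauer_rec lam k t
    have p0 := gegenbauer_eval_one_pos hlam k
    have p1 := gegenbauer_eval_one_pos hlam (k + 1)
    have p2 := gegenbauer_eval_one_pos hlam (k + 2)
    rw [Nat.add_sub_cancel]
    push_cast at *
    have e2 : (gegenbauer lam (k + 2)).eval 1 =
        (k + 1 + 2 * lam) * (gegenbauer lam (k + 1)).eval 1 / (k + 2) := by
      field_simp
      linear_combination h2
    have e1 : (gegenbauer lam (k + 1)).eval 1 =
        (k + 2 * lam) * (gegenbauer lam k).eval 1 / (k + 1) := by
      field_simp
      linear_combination h1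
    have hk : (k : ℝ) + 2 * lam ≠ 0 := by positivity
    have hk' : (k : ℝ) + 1 + 2 * lam ≠ 0 := by positivity
    rw [e2, e1]
    field_simp
    linear_combination h3

/-- For `μ < 1/2` the weight is singular at the ends of the chord. On the half `[0, σ]` only the
factor `σ - s` of `σ² - s²` vanishes, with exponent above `-1`; the other half follows by
reflection. -/
lemma intervalIntegrable_diskWeight {μ : ℝ} (hμ : 0 ≤ μ) {t : ℝ} (ht : t ∈ Set.Ioo (-1 : ℝ) 1) :
    IntervalIntegrable (fun s => diskWeight μ s t) MeasureTheory.volume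
      (-Real.sqrt (1 - t ^ 2)) (Real.sqrt (1 - t ^ 2)) := by
  have h0 : 0 < 1 - t ^ 2 := by nlinarith [ht.1, ht.2]
  set σ := Real.sqrt (1 - t ^ 2) with hσ
  have hσ0 : 0 < σ := Real.sqrt_pos.mpr h0
  have hσ2 : σ ^ 2 = 1 - t ^ 2 := Real.sq_sqrt h0.le
  have h1 : IntervalIntegrable (fun s : ℝ => (σ - s) ^ (μ - 1 / 2) * (σ + s) ^ (μ - 1 / 2))
      MeasureTheory.volume 0 σ := by
    refine IntervalIntegrable.mul_continuousOn ?_ ?_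
    · have h := (intervalIntegral.intervalIntegrable_rpow' (a := 0) (b := σ)
        (by linarith : -1 < μ - 1 / 2)).comp_sub_left σ
      simp only [sub_zero, sub_self] at h
      exact h.symm
    · intro x hx
      rw [Set.uIcc_of_le hσ0.le] at hx
      have : σ + x ≠ 0 := by have := hx.1; positivity
      exact (((continuous_const.add continuous_id).continuousAt).rpow_const
        (Or.inl this)).continuousWithinAt
  have h2 : IntervalIntegrable (fun s => diskWeight μ s t) MeasureTheory.volume 0 σ := by
    refine h1.congr fun s hs => ?_
    rw [Set.uIoc_of_le hσ0.le] at hs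
    simp only [diskWeight]
    rw [← Real.mul_rpow (by linarith [hs.2]) (by linarith [hs.1])]
    congr 1
    linear_combination hσ2
  have h3 : IntervalIntegrable (fun s => diskWeight μ s t) MeasureTheory.volume (-σ) 0 := by
    rw [IntervalIntegrable.iff_comp_neg]
    simpa [diskWeight] using h2.symm
  exact h3.trans h2

/-- Integration against the weight of the disk along the chord with parameter `t`. -/
noncomputable def chordInt (μ t : ℝ) (f : ℝ → ℂ) : ℂ :=
  ∫ s in (-Real.sqrt (1 - t ^ 2))..Real.sqrt (1 - t ^ 2), f s * (diskWeight μ s t : ℂ)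

lemma intervalIntegrable_mul_diskWeight {μ : ℝ} (hμ : 0 ≤ μ) {t : ℝ}
    (ht : t ∈ Set.Ioo (-1 : ℝ) 1) {f : ℝ → ℂ} (hf : Continuous f) :
    IntervalIntegrable (fun s => f s * (diskWeight μ s t : ℂ)) MeasureTheory.volume
      (-Real.sqrt (1 - t ^ 2)) (Real.sqrt (1 - t ^ 2)) :=
  IntervalIntegrable.continuousOn_mul
    ⟨(intervalIntegrable_diskWeight hμ ht).1.ofReal, (intervalIntegrable_diskWeight hμ ht).2.ofReal⟩
    hf.continuousOn

lemma chordInt_add {μ : ℝ} (hμ : 0 ≤ μ) {t : ℝ} (ht : t ∈ Set.Ioo (-1 : ℝ) 1) {f g : ℝ → ℂ}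
    (hf : Continuous f) (hg : Continuous g) :
    chordInt μ t (fun s => f s + g s) = chordInt μ t f + chordInt μ t g := by
  unfold chordInt
  simp only [add_mul]
  exact intervalIntegral.integral_add (intervalIntegrable_mul_diskWeight hμ ht hf)
    (intervalIntegrable_mul_diskWeight hμ ht hg)

lemma chordInt_const_mul (μ t : ℝ) (c : ℂ) (f : ℝ → ℂ) :
    chordInt μ t (fun s => c * f s) = c * chordInt μ t f := by
  unfold chordInt
  simp only [mul_assoc]
  exact intervalIntegral.integral_const_mul _ _

/-- With `z = t + s i`, integrate the derivative of `i (1 - |z|²)^(μ+1/2) z^m`, which vanishes at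
the ends of the chord, and use `s i = z - t` and `|z|² = z (2t - z)`. The result is the recurrence
of `normGegenbauer_rec`. -/
lemma chordInt_pow_rec {μ : ℝ} (hμ : 0 ≤ μ) {t : ℝ} (ht : t ∈ Set.Ioo (-1 : ℝ) 1) (m : ℕ) :
    ((m + 2 * (μ + 1 / 2) : ℝ) : ℂ) * chordInt μ t (fun s => (t + s * Complex.I) ^ (m + 1)) =
      ((2 * (m + (μ + 1 / 2)) * t : ℝ) : ℂ) * chordInt μ t (fun s => (t + s * Complex.I) ^ m)
        - m * chordInt μ t (fun s => (t + s * Complex.I) ^ (m - 1)) := by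
  have h0 : 0 < 1 - t ^ 2 := by nlinarith [ht.1, ht.2]
  set σ := Real.sqrt (1 - t ^ 2) with hσ
  have hσ0 : 0 < σ := Real.sqrt_pos.mpr h0
  have hσ2 : σ ^ 2 = 1 - t ^ 2 := Real.sq_sqrt h0.le
  have hcont (j : ℕ) : Continuous fun s : ℝ => ((t : ℂ) + s * Complex.I) ^ j := by fun_prop
  have hc : Continuous fun s : ℝ =>
      (((1 - s ^ 2 - t ^ 2) ^ (μ + 1 / 2) : ℝ) : ℂ) * ((t : ℂ) + s * Complex.I) ^ m :=
    (Complex.continuous_ofReal.comp ((by fun_prop : Continuous fun s : ℝ => 1 - s ^ 2 - t ^ 2).rpow_const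
      fun _ => Or.inr (by linarith))).mul (hcont m)
  have hd : ∀ x ∈ Set.Ioo (-σ) σ, HasDerivAt (fun s : ℝ => Complex.I *
        ((((1 - s ^ 2 - t ^ 2) ^ (μ + 1 / 2) : ℝ) : ℂ) * ((t : ℂ) + s * Complex.I) ^ m))
      ((((2 * (m + (μ + 1 / 2)) * t : ℝ) : ℂ) * (t + x * Complex.I) ^ m
        + (-((m + 2 * (μ + 1 / 2) : ℝ) : ℂ) * (t + x * Complex.I) ^ (m + 1)
        + (-m) * (t + x * Complex.I) ^ (m - 1))) * (diskWeight μ x t : ℂ)) x := by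
    intro x hx
    have hpos : 0 < 1 - x ^ 2 - t ^ 2 := by nlinarith [hx.1, hx.2]
    have h1 : HasDerivAt (fun s : ℝ => 1 - s ^ 2 - t ^ 2) (-(2 * x)) x := by
      simpa using ((hasDerivAt_pow 2 x).const_sub 1).sub_const (t ^ 2)
    have h2 := (h1.rpow_const (p := μ + 1 / 2) (Or.inl hpos.ne')).ofReal_comp
    have h3 : HasDerivAt (fun s : ℝ => (t : ℂ) + s * Complex.I) (1 * Complex.I) x :=
      ((Complex.ofRealCLM.hasDerivAt (x := x)).mul_const Complex.I).const_add _
    refine ((h2.mul (h3.fun_pow m)).const_mul Complex.I).congr_deriv ?_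
    have h4 : (1 - x ^ 2 - t ^ 2) ^ (μ + 1 / 2) =
        (1 - x ^ 2 - t ^ 2) ^ (μ - 1 / 2) * (1 - x ^ 2 - t ^ 2) := by
      rw [← Real.rpow_add_one hpos.ne']; congr 1; ring
    have h5 : μ + 1 / 2 - 1 = μ - 1 / 2 := by ring
    rw [h4, h5]
    unfold diskWeight
    generalize (1 - x ^ 2 - t ^ 2) ^ (μ - 1 / 2) = W
    have hI := Complex.I_sq
    rcases m with _ | m
    · push_cast
      simp only [pow_zero, zero_add, pow_one]
      ring
    · simp only [Nat.add_sub_cancel]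
      push_cast
      rw [pow_succ _ (m + 1), pow_succ _ m]
      generalize ((t : ℂ) + x * Complex.I) ^ m = Z
      linear_combination (W * Z * (((m : ℂ) + 1) * (1 - t ^ 2))) * hI
  have hint := (intervalIntegrable_mul_diskWeight hμ ht (f := fun x =>
    ((2 * (m + (μ + 1 / 2)) * t : ℝ) : ℂ) * (t + x * Complex.I) ^ m
        + (-((m + 2 * (μ + 1 / 2) : ℝ) : ℂ) * (t + x * Complex.I) ^ (m + 1)
        + (-m) * (t + x * Complex.I) ^ (m - 1))) (by fun_prop))
  have h := intervalIntegral.integral_eq_sub_of_hasDerivAt_of_le (by linarith)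
    (continuous_const.mul hc).continuousOn hd hint
  have e0 : 1 - σ ^ 2 - t ^ 2 = 0 := by linear_combination -hσ2
  simp only [Pi.mul_apply] at h
  rw [neg_sq, e0, Real.zero_rpow (by linarith)] at h
  simp only [Complex.ofReal_zero, zero_mul, mul_zero, sub_zero] at h
  have h' : chordInt μ t (fun x =>
    ((2 * (m + (μ + 1 / 2)) * t : ℝ) : ℂ) * (t + x * Complex.I) ^ m
        + (-((m + 2 * (μ + 1 / 2) : ℝ) : ℂ) * (t + x * Complex.I) ^ (m + 1)
        + (-m) * (t + x * Complex.I) ^ (m - 1))) = 0 := h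
  rw [chordInt_add hμ ht (by fun_prop) (by fun_prop), chordInt_add hμ ht (by fun_prop) (by fun_prop),
    chordInt_const_mul, chordInt_const_mul, chordInt_const_mul] at h'
  linear_combination -h'

lemma chordInt_pow {μ : ℝ} (hμ : 0 ≤ μ) {t : ℝ} (ht : t ∈ Set.Ioo (-1 : ℝ) 1) (m : ℕ) :
    chordInt μ t (fun s => (t + s * Complex.I) ^ m) =
        (normGegenbauer (μ + 1 / 2) m t : ℂ) * chordInt μ t (fun _ => 1) ∧
      chordInt μ t (fun s => (t + s * Complex.I) ^ (m + 1)) =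
        (normGegenbauer (μ + 1 / 2) (m + 1) t : ℂ) * chordInt μ t (fun _ => 1) := by
  have hlam : 0 < μ + 1 / 2 := by linarith
  -- The assumption on the index `m - 1` carries the factor `m`, so it is void at `m = 0`.
  have key (m : ℕ) (h1 : chordInt μ t (fun s => (t + s * Complex.I) ^ m) =
        (normGegenbauer (μ + 1 / 2) m t : ℂ) * chordInt μ t (fun _ => 1))
      (h2 : (m : ℂ) * chordInt μ t (fun s => (t + s * Complex.I) ^ (m - 1)) =
        m * ((normGegenbauer (μ + 1 / 2) (m - 1) t : ℂ) * chordInt μ t (fun _ => 1))) :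
      chordInt μ t (fun s => (t + s * Complex.I) ^ (m + 1)) =
        (normGegenbauer (μ + 1 / 2) (m + 1) t : ℂ) * chordInt μ t (fun _ => 1) := by
    have h3 := chordInt_pow_rec hμ ht m
    have h4 := congrArg Complex.ofReal (normGegenbauer_rec hlam m t)
    have hp : ((m + 2 * (μ + 1 / 2) : ℝ) : ℂ) ≠ 0 :=
      Complex.ofReal_ne_zero.mpr (by positivity)
    apply mul_left_cancel₀ hp
    rw [h3, h1, h2]
    push_cast at h4 ⊢
    linear_combination -(chordInt μ t (fun _ => 1)) * h4
  induction m with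
  | zero =>
    have h : chordInt μ t (fun s => (t + s * Complex.I) ^ 0) =
        (normGegenbauer (μ + 1 / 2) 0 t : ℂ) * chordInt μ t (fun _ => 1) := by
      simp [normGegenbauer_zero]
    exact ⟨h, key 0 h (by simp)⟩
  | succ m ih =>
    exact ⟨ih.2, key (m + 1) ih.2 (by rw [Nat.add_sub_cancel, ih.1])⟩

/-- The polynomial `normJacobi lam m l (|z|² - 1) z^m` on the chord `z = t + s i`. -/
noncomputable def chordPoly (lam : ℝ) (m l : ℕ) (t s : ℝ) : ℂ :=
  (normJacobi lam m l (t ^ 2 + s ^ 2 - 1) : ℂ) * (t + s * Complex.I) ^ m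

lemma continuous_chordPoly (lam : ℝ) (m l : ℕ) (t : ℝ) : Continuous (chordPoly lam m l t) := by
  unfold chordPoly
  have := continuous_normJacobi lam m l
  fun_prop

/-- Uses `2 t z = |z|² + z²` on the chord: the factor `|z|²` is absorbed by the lowering relation,
and `z²` goes with the raising one. -/
lemma chordPoly_rec {lam : ℝ} (hlam : 0 < lam) (m l : ℕ) (t s : ℝ) :
    ((l + lam : ℝ) : ℂ) * chordPoly lam m (l + 1) t s + (((l + m + 1 : ℝ) : ℂ) * chordPoly lam m l t s
      + (((l + lam + m + 1 : ℝ) : ℂ) * chordPoly lam (m + 2) l t s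
      + (l : ℂ) * chordPoly lam (m + 2) (l - 1) t s)) =
      ((2 * (2 * l + lam + m + 1) * t : ℝ) : ℂ) * chordPoly lam (m + 1) l t s := by
  have h1 := congrArg Complex.ofReal (normJacobi_lower hlam m l (t ^ 2 + s ^ 2 - 1))
  have h2 := congrArg Complex.ofReal
    (normJacobi_raise (lam := lam) (m + 1) l (t ^ 2 + s ^ 2 - 1))
  unfold chordPoly
  push_cast at h1 h2 ⊢
  rw [pow_succ _ (m + 1), pow_succ _ m]
  generalize ((t : ℂ) + s * Complex.I) ^ m = Z
  have hI := Complex.I_sq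
  linear_combination (-Z) * h1 - (Z * (t + s * Complex.I) ^ 2) * h2
    + (Z * (2 * l + lam + m + 1) * s ^ 2 * normJacobi lam (m + 1) l (t ^ 2 + s ^ 2 - 1)) * hI

/-- Marr's formula on a chord. -/
lemma chordInt_chordPoly {μ : ℝ} (hμ : 0 ≤ μ) {t : ℝ} (ht : t ∈ Set.Ioo (-1 : ℝ) 1) (l : ℕ) :
    ∀ m, chordInt μ t (chordPoly (μ + 1 / 2) m l t) =
      (normGegenbauer (μ + 1 / 2) (m + 2 * l) t : ℂ) * chordInt μ t (fun _ => 1) := by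
  have hlam : 0 < μ + 1 / 2 := by linarith
  induction l using Nat.strong_induction_on with
  | _ l ih =>
    intro m
    rcases l with _ | l
    · have e : chordPoly (μ + 1 / 2) m 0 t = fun s : ℝ => ((t : ℂ) + s * Complex.I) ^ m := by
        ext s
        simp [chordPoly]
      rw [e]
      exact (chordInt_pow hμ ht m).1
    -- The recurrence expresses the case `l + 1` by smaller `l`. Terms on its left have total degree
    -- `k + 1` or `k - 1` with `k = m + 1 + 2l`, and their coefficients add up to those of the
    -- Gegenbauer recurrence at `k`.
    · have hrec := congrArg (chordInt μ t) (funext (chordPoly_rec hlam m l t))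
      have hc := fun m l => continuous_chordPoly (μ + 1 / 2) m l t
      rw [chordInt_add hμ ht, chordInt_add hμ ht, chordInt_add hμ ht] at hrec
      · simp only [chordInt_const_mul] at hrec
        have hl : (l : ℂ) * chordInt μ t (chordPoly (μ + 1 / 2) (m + 2) (l - 1) t) =
            l * ((normGegenbauer (μ + 1 / 2) (m + 2 * l) t : ℂ) * chordInt μ t (fun _ => 1)) := by
          rcases l with _ | l
          · simp
          · rw [Nat.add_sub_cancel, ih l (by omega) (m + 2)]
            congr 4; ring
        have hg := congrArg Complex.ofReal (normGegenbauer_rec hlam (m + 1 + 2 * l) t)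
        have e1 : m + 1 + 2 * l + 1 = m + 2 * (l + 1) := by ring
        have e2 : m + 1 + 2 * l - 1 = m + 2 * l := by omega
        have e3 : m + 2 + 2 * l = m + 2 * (l + 1) := by ring
        have i1 := ih l (by omega) m
        have i2 := ih l (by omega) (m + 1)
        have i3 := ih l (by omega) (m + 2)
        rw [e1, e2] at hg
        rw [e3] at i3
        have h1 : chordInt μ t (fun s => chordPoly (μ + 1 / 2) m l t s) = _ := i1
        have h2 : chordInt μ t (fun s => chordPoly (μ + 1 / 2) (m + 1) l t s) = _ := i2
        have h3 : chordInt μ t (fun s => chordPoly (μ + 1 / 2) (m + 2) l t s) = _ := i3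
        have h4 : (l : ℂ) * chordInt μ t (fun s => chordPoly (μ + 1 / 2) (m + 2) (l - 1) t s) = _ :=
          hl
        rw [h1, h2, h3, h4] at hrec
        have hp : ((l + (μ + 1 / 2) : ℝ) : ℂ) ≠ 0 :=
          Complex.ofReal_ne_zero.mpr (by positivity)
        apply mul_left_cancel₀ hp
        change _ * chordInt μ t (fun s => chordPoly (μ + 1 / 2) m (l + 1) t s) = _
        push_cast at hg hrec ⊢
        linear_combination hrec - (chordInt μ t (fun _ => 1)) * hg
      all_goals
        have := hc m l
        have := hc m (l + 1)
        have := hc (m + 2) l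
        have := hc (m + 2) (l - 1)
        fun_prop

/-! ### The constants in the chord integrals. -/

lemma integral_one_sub_sq_rpow {p : ℝ} (hp : -1 < p) :
    ∫ u in (-1 : ℝ)..1, (1 - u ^ 2) ^ p =
      2 * 4 ^ p * (Real.Gamma (p + 1) ^ 2 / Real.Gamma (2 * p + 2)) := by
  have h1 := intervalIntegral.integral_comp_mul_sub (a := 0) (b := 1)
    (fun u : ℝ => (1 - u ^ 2) ^ p) (two_ne_zero' ℝ) 1
  norm_num at h1
  have h2 : ∫ x in (0 : ℝ)..1, (1 - (2 * x - 1) ^ 2) ^ p =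
      4 ^ p * ∫ x in (0 : ℝ)..1, x ^ p * (1 - x) ^ p := by
    rw [← intervalIntegral.integral_const_mul]
    refine intervalIntegral.integral_congr fun x hx => ?_
    rw [Set.uIcc_of_le zero_le_one] at hx
    have h3 : 0 ≤ 1 - x := by linarith [hx.2]
    rw [← Real.mul_rpow hx.1 h3, ← Real.mul_rpow (by norm_num) (mul_nonneg hx.1 h3)]
    congr 1
    ring
  have h4 : ((∫ x in (0 : ℝ)..1, x ^ p * (1 - x) ^ p : ℝ) : ℂ) =
      Complex.betaIntegral ((p + 1 : ℝ) : ℂ) ((p + 1 : ℝ) : ℂ) := by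
    rw [Complex.betaIntegral, ← intervalIntegral.integral_ofReal]
    refine intervalIntegral.integral_congr fun x hx => ?_
    rw [Set.uIcc_of_le zero_le_one] at hx
    have h3 : 0 ≤ 1 - x := by linarith [hx.2]
    push_cast
    rw [add_sub_cancel_right, Complex.ofReal_cpow hx.1, Complex.ofReal_cpow h3]
    push_cast
    rfl
  have h5 := ProbabilityTheory.beta_eq_betaIntegralReal (p + 1) (p + 1) (by linarith) (by linarith)
  rw [← h4, Complex.ofReal_re, ProbabilityTheory.beta] at h5
  rw [h2, ← h5] at h1
  have e : p + 1 + (p + 1) = 2 * p + 2 := by ring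
  rw [e] at h1
  linear_combination -2 * h1

/-- The integral of `(1 - u²)^(μ - 1/2)` over `[-1, 1]`. -/
noncomputable def chordConst (μ : ℝ) : ℝ := ∫ u in (-1 : ℝ)..1, (1 - u ^ 2) ^ (μ - 1 / 2)

/-- Slicing the disk into chords explains the identity: the product of the two integrals is the
total mass of the disk weight. The proof uses the Beta integral and Legendre's duplication formula
at `μ + 1/2`. -/
lemma chordConst_mul {μ : ℝ} (hμ : 0 ≤ μ) :
    diskConst μ * chordConst μ * gegenbauerInt μ hμ 1 = 1 := by
  have h1 : gegenbauerInt μ hμ 1 = ∫ u in (-1 : ℝ)..1, (1 - u ^ 2) ^ μ := by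
    simp [gegenbauerInt]
  rw [h1, chordConst, integral_one_sub_sq_rpow (by linarith), integral_one_sub_sq_rpow (by linarith)]
  have e1 : μ - 1 / 2 + 1 = μ + 1 / 2 := by ring
  have e2 : 2 * (μ - 1 / 2) + 2 = 2 * μ + 1 := by ring
  have e3 : 2 * μ + 2 = 2 * μ + 1 + 1 := by ring
  rw [e1, e2, e3, Real.Gamma_add_one (s := 2 * μ + 1) (by positivity)]
  have hd := Real.Gamma_mul_Gamma_add_half (μ + 1 / 2)
  have e4 : μ + 1 / 2 + 1 / 2 = μ + 1 := by ring
  have e5 : 2 * (μ + 1 / 2) = 2 * μ + 1 := by ring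
  have e6 : 1 - (2 * μ + 1) = -(2 * μ) := by ring
  have e7 : (2 : ℝ) ^ (-(2 * μ)) = ((4 : ℝ) ^ μ)⁻¹ := by
    rw [Real.rpow_neg (by norm_num), Real.rpow_mul (by norm_num)]
    norm_num
  have e8 : (4 : ℝ) ^ (μ - 1 / 2) = 4 ^ μ / 2 := by
    rw [Real.rpow_sub (by norm_num), ← Real.sqrt_eq_rpow]
    congr 1
    rw [show (4 : ℝ) = 2 ^ 2 by norm_num, Real.sqrt_sq (by norm_num)]
  rw [e4, e5, e6, e7] at hd
  rw [e8, diskConst]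
  have hG := (Real.Gamma_pos_of_pos (by linarith : 0 < 2 * μ + 1)).ne'
  have h4 : (4 : ℝ) ^ μ ≠ 0 := by positivity
  have hpi := Real.pi_ne_zero
  have hμ' : 2 * μ + 1 ≠ 0 := by positivity
  have hs : Real.sqrt Real.pi ^ 2 = Real.pi := Real.sq_sqrt Real.pi_pos.le
  have hd2 : (Real.Gamma (μ + 1 / 2) * Real.Gamma (μ + 1)) ^ 2 * ((4 : ℝ) ^ μ) ^ 2 =
      Real.Gamma (2 * μ + 1) ^ 2 * Real.pi := by
    rw [hd, mul_pow, mul_pow, hs]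
    field_simp
  generalize Real.Gamma (μ + 1 / 2) = A at hd2 ⊢
  generalize Real.Gamma (μ + 1) = B at hd2 ⊢
  generalize Real.Gamma (2 * μ + 1) = D at hd2 hG ⊢
  generalize (4 : ℝ) ^ μ = F at hd2 h4 ⊢
  field_simp
  linear_combination hd2

lemma chordInt_one (μ : ℝ) {t : ℝ} (ht : t ∈ Set.Ioo (-1 : ℝ) 1) :
    chordInt μ t (fun _ => 1) = ((1 - t ^ 2) ^ μ * chordConst μ : ℝ) := by
  have h0 : 0 < 1 - t ^ 2 := by nlinarith [ht.1, ht.2]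
  unfold chordInt
  simp only [one_mul]
  rw [intervalIntegral.integral_ofReal]
  congr 1
  set σ := Real.sqrt (1 - t ^ 2) with hσ
  have hσ0 : 0 < σ := Real.sqrt_pos.mpr h0
  have hσ2 : σ ^ 2 = 1 - t ^ 2 := Real.sq_sqrt h0.le
  have h1 := intervalIntegral.integral_comp_mul_left (a := -1) (b := 1)
    (fun s => diskWeight μ s t) hσ0.ne'
  have h2 : ∫ u in (-1 : ℝ)..1, diskWeight μ (σ * u) t =
      (1 - t ^ 2) ^ (μ - 1 / 2) * chordConst μ := by
    rw [chordConst, ← intervalIntegral.integral_const_mul]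
    refine intervalIntegral.integral_congr fun u hu => ?_
    rw [Set.uIcc_of_le (by norm_num)] at hu
    have : 0 ≤ 1 - u ^ 2 := by nlinarith [hu.1, hu.2]
    simp only [diskWeight]
    rw [← Real.mul_rpow h0.le this]
    congr 1
    linear_combination (-u ^ 2) * hσ2
  rw [h2, mul_neg_one, mul_one, smul_eq_mul] at h1
  have h3 : (1 - t ^ 2) ^ μ = σ * (1 - t ^ 2) ^ (μ - 1 / 2) := by
    rw [hσ, Real.sqrt_eq_rpow, ← Real.rpow_add h0]
    congr 1
    ring
  rw [h3, mul_assoc, h1]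
  field_simp

/-- The basis polynomials of the disk, normalized to have radial part one at `r = 1`. -/
noncomputable def diskPoly (lam : ℝ) (m l : ℕ) (ε : Fin 2) (x y : ℝ) : ℝ :=
  normJacobi lam m l (x ^ 2 + y ^ 2 - 1) * harmonic m ε x y

lemma harmonic_cos_sin (m : ℕ) (ε : Fin 2) (ξ : ℝ) :
    harmonic m ε (Real.cos ξ) (Real.sin ξ) =
      if ε = 0 then Real.cos (m * ξ) else Real.sin (m * ξ) := by
  unfold harmonic
  have : ((Real.cos ξ : ℂ) + Real.sin ξ * Complex.I) ^ m =
      Real.cos (m * ξ) + Real.sin (m * ξ) * Complex.I := by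
    push_cast
    exact Complex.cos_add_sin_mul_I_pow m ξ
  rw [this]
  simp [-Complex.ofReal_cos, -Complex.ofReal_sin]

lemma diskPoly_cos_sin (lam : ℝ) (m l : ℕ) (ε : Fin 2) (ξ : ℝ) :
    diskPoly lam m l ε (Real.cos ξ) (Real.sin ξ) =
      harmonic m ε (Real.cos ξ) (Real.sin ξ) := by
  simp [diskPoly]

/-- Marr's formula. -/
lemma radon_diskPoly {μ : ℝ} (hμ : 0 ≤ μ) {t : ℝ} (ht : t ∈ Set.Ioo (-1 : ℝ) 1) (m l : ℕ)
    (ε : Fin 2) (θ : ℝ) :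
    radon μ (diskPoly (μ + 1 / 2) m l ε) θ t =
      chordConst μ * (1 - t ^ 2) ^ μ * normGegenbauer (μ + 1 / 2) (m + 2 * l) t *
        harmonic m ε (Real.cos θ) (Real.sin θ) := by
  have hc := continuous_chordPoly (μ + 1 / 2) m l t
  set e : ℂ := (Real.cos θ + Real.sin θ * Complex.I) ^ m with he
  have h := chordInt_const_mul μ t e (chordPoly (μ + 1 / 2) m l t)
  rw [chordInt_chordPoly hμ ht, chordInt_one μ ht] at h
  have hint := intervalIntegrable_mul_diskWeight hμ ht
    (f := fun s => e * chordPoly (μ + 1 / 2) m l t s) (by fun_prop)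
  -- The chord in direction `θ` is `exp(iθ) (t + s i)`, so the rotation only contributes the
  -- constant `e = exp(imθ)`; the rest of the integral is real.
  have hrot (s : ℝ) : (((t * Real.cos θ - s * Real.sin θ : ℝ) : ℂ) +
      ((t * Real.sin θ + s * Real.cos θ : ℝ) : ℂ) * Complex.I) ^ m = e * (t + s * Complex.I) ^ m := by
    rw [he, ← mul_pow]
    congr 1
    push_cast
    linear_combination (-(s : ℂ) * Complex.sin θ) * Complex.I_sq
  have hr (s : ℝ) : (t * Real.cos θ - s * Real.sin θ) ^ 2 + (t * Real.sin θ + s * Real.cos θ) ^ 2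
      = t ^ 2 + s ^ 2 := by
    linear_combination (t ^ 2 + s ^ 2) * Real.sin_sq_add_cos_sq θ
  have hval : radon μ (diskPoly (μ + 1 / 2) m l ε) θ t =
      if ε = 0 then (chordInt μ t fun s => e * chordPoly (μ + 1 / 2) m l t s).re
      else (chordInt μ t fun s => e * chordPoly (μ + 1 / 2) m l t s).im := by
    unfold radon chordInt
    split_ifs with hε
    · rw [← Complex.reCLM_apply, ← ContinuousLinearMap.intervalIntegral_comp_comm Complex.reCLM hint]
      congr 1
      ext s
      simp only [diskPoly, harmonic, if_pos hε, hrot, hr, Complex.reCLM_apply, chordPoly,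
        Complex.re_mul_ofReal]
      rw [mul_left_comm e, Complex.re_ofReal_mul]
    · rw [← Complex.imCLM_apply, ← ContinuousLinearMap.intervalIntegral_comp_comm Complex.imCLM hint]
      congr 1
      ext s
      simp only [diskPoly, harmonic, if_neg hε, hrot, hr, Complex.imCLM_apply, chordPoly,
        Complex.im_mul_ofReal]
      rw [mul_left_comm e, Complex.im_ofReal_mul]
  rw [hval, h, ← Complex.ofReal_mul]
  unfold harmonic
  rw [← he]
  split_ifs
  · rw [Complex.re_mul_ofReal]; ring
  · rw [Complex.im_mul_ofReal]; ring

/-! ### Discrete orthogonality of trigonometric polynomials -/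

/-- A geometric sum over powers of `exp(2πip/(n+1))`, which is 1 for `|p| ≤ n` only if `p = 0`. -/
lemma sum_direction {n : ℕ} {p : ℤ} (hp : |p| ≤ n) :
    (∑ ν : Fin (n + 1), Real.cos (2 * p * direction n ν) = if p = 0 then (n : ℝ) + 1 else 0) ∧
      ∑ ν : Fin (n + 1), Real.sin (2 * p * direction n ν) = 0 := by
  by_cases hp0 : p = 0
  · simp [hp0]
  have hn : (n : ℂ) + 1 ≠ 0 := by exact_mod_cast Nat.succ_ne_zero n
  have hpi : (Real.pi : ℂ) ≠ 0 := by exact_mod_cast Real.pi_ne_zero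
  set w : ℂ := Complex.exp (2 * p * Real.pi / (n + 1) * Complex.I) with hw
  have hw1 : w ≠ 1 := by
    intro h
    obtain ⟨q, hq⟩ := Complex.exp_eq_one_iff.mp h
    have h2 : (p : ℂ) = q * (n + 1) := by
      have hI := Complex.I_ne_zero
      field_simp at hq
      linear_combination hq
    have h3 : p = q * (n + 1) := by exact_mod_cast h2
    have h4 : ((n : ℤ) + 1) ∣ p := ⟨q, by rw [h3]; ring⟩
    have := Int.eq_zero_of_abs_lt_dvd h4 (by linarith)
    exact hp0 this
  have hwn : w ^ (n + 1) = 1 := by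
    rw [hw, ← Complex.exp_nat_mul]
    rw [Complex.exp_eq_one_iff]
    refine ⟨p, ?_⟩
    push_cast
    field_simp
  have hsum : ∑ ν : Fin (n + 1), w ^ (ν : ℕ) = 0 := by
    rw [Fin.sum_univ_eq_sum_range (fun i => w ^ i), geom_sum_eq hw1, hwn]
    simp
  have hterm (ν : Fin (n + 1)) : w ^ (ν : ℕ) =
      Complex.exp (((2 * p * direction n ν : ℝ) : ℂ) * Complex.I) := by
    rw [hw, ← Complex.exp_nat_mul, direction]
    congr 1
    push_cast
    ring
  simp only [hterm] at hsum
  constructor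
  · have := congrArg Complex.re hsum
    simpa only [Complex.re_sum, Complex.exp_ofReal_mul_I_re, Complex.zero_re, if_neg hp0] using this
  · have := congrArg Complex.im hsum
    simpa only [Complex.im_sum, Complex.exp_ofReal_mul_I_im, Complex.zero_im] using this

/-- Equal parity makes the frequencies `m ± m'` even, as `sum_direction` requires. The weight 1 or 2
offsets the mean square 1 or 1/2; the last factor disposes of the zero function `m' = 0`, `ε' = 1`.
-/
lemma sum_harmonic_mul_harmonic {n m m' : ℕ} (hm : m ≤ n) (hm' : m' ≤ n) (h : m % 2 = m' % 2)
    (ε ε' : Fin 2) (x y : ℝ) :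
    (if m' = 0 then 1 else 2) * (∑ ν : Fin (n + 1),
        harmonic m ε (Real.cos (direction n ν)) (Real.sin (direction n ν)) *
          harmonic m' ε' (Real.cos (direction n ν)) (Real.sin (direction n ν))) *
        harmonic m' ε' x y =
      if m = m' ∧ ε = ε' then (n + 1) * harmonic m ε x y else 0 := by
  obtain ⟨p, hp⟩ : ∃ p : ℤ, (m : ℤ) + m' = 2 * p := ⟨((m : ℤ) + m') / 2, by omega⟩
  obtain ⟨q, hq⟩ : ∃ q : ℤ, (m : ℤ) - m' = 2 * q := ⟨((m : ℤ) - m') / 2, by omega⟩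
  obtain ⟨cp, sp⟩ := sum_direction (n := n) (p := p) (abs_le.mpr ⟨by omega, by omega⟩)
  obtain ⟨cq, sq⟩ := sum_direction (n := n) (p := q) (abs_le.mpr ⟨by omega, by omega⟩)
  have hp' : (m : ℝ) + m' = 2 * p := by exact_mod_cast hp
  have hq' : (m : ℝ) - m' = 2 * q := by exact_mod_cast hq
  have a1 (z : ℝ) : 2 * p * z = m * z + m' * z := by rw [← hp']; ring
  have a2 (z : ℝ) : 2 * q * z = m * z - m' * z := by rw [← hq']; ring
  simp only [a1, a2, Real.cos_add, Real.cos_sub, Real.sin_add, Real.sin_sub,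
    Finset.sum_add_distrib, Finset.sum_sub_distrib] at cp sp cq sq
  have hpz : p = 0 ↔ m = 0 ∧ m' = 0 := by omega
  have hqz : q = 0 ↔ m = m' := by omega
  simp only [hpz, hqz] at cp cq
  simp only [harmonic_cos_sin]
  have hh : m' = 0 → ε' = 1 → harmonic m' ε' x y = 0 := by
    rintro rfl rfl
    simp [harmonic]
  by_cases hmm : m = m'
  · subst hmm
    by_cases hm0 : m = 0
    · subst hm0
      fin_cases ε <;> fin_cases ε' <;> simp [harmonic]
    · simp only [hm0, and_self, if_false, if_true] at cp cq ⊢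
      fin_cases ε <;> fin_cases ε' <;> simp
      · left; linear_combination cp + cq
      · exact Or.inl (by linarith)
      · exact Or.inl (by linarith)
      · left; linear_combination cq - cp
  · have hmm2 : ¬ (m = 0 ∧ m' = 0) := fun h => hmm (h.1.trans h.2.symm)
    simp only [hmm, hmm2, false_and, if_false] at cp cq ⊢
    have h0 : (∑ ν : Fin (n + 1),
        (if ε = 0 then Real.cos (m * direction n ν) else Real.sin (m * direction n ν)) *
          (if ε' = 0 then Real.cos (m' * direction n ν) else Real.sin (m' * direction n ν))) = 0 := by
      fin_cases ε <;> fin_cases ε' <;> simp <;> linarith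
    rw [h0]
    simp

/-! ### The kernel -/

lemma diskBasis_eq (μ : ℝ) (hμ : 0 ≤ μ) (k l : ℕ) (ε : Fin 2) (x y : ℝ) :
    diskBasis μ k l ε x y = basisConst μ k l /
      Real.sqrt (jacobiNormSq (μ + 1 / 2) (k - 2 * l) l /
        jacobiInt (μ + 1 / 2) (k - 2 * l) (fun _ => 1)) *
      diskPoly (μ + 1 / 2) (k - 2 * l) l ε x y := by
  have e : μ - 1 / 2 = μ + 1 / 2 - 1 := by ring
  unfold diskBasis diskPoly
  rw [e, jacobiON_eq (by linarith)]
  have e2 : (2 * (x ^ 2 + y ^ 2) - 1 - 1) / 2 = x ^ 2 + y ^ 2 - 1 := by ring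
  rw [e2]
  ring

lemma basisConst_sq {μ : ℝ} (hμ : 0 ≤ μ) (k l : ℕ) :
    basisConst μ k l ^ 2 = (if k = 2 * l then 1 else 2) *
      (poch (μ + 3 / 2) (k - 2 * l) / ((k - 2 * l).factorial : ℝ)) := by
  have hG := Real.Gamma_pos_of_pos (by linarith : 0 < μ + 3 / 2)
  have hp := poch_pos (by linarith : 0 < μ + 3 / 2) (k - 2 * l)
  have e : ((k - 2 * l : ℕ) : ℝ) + μ + 3 / 2 = μ + 3 / 2 + ((k - 2 * l : ℕ) : ℝ) := by ring
  have e2 : poch (μ + 3 / 2) (k - 2 * l) * Real.Gamma (μ + 3 / 2) /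
      (Real.Gamma (μ + 3 / 2) * ((k - 2 * l).factorial : ℝ)) =
      poch (μ + 3 / 2) (k - 2 * l) / ((k - 2 * l).factorial : ℝ) := by
    field_simp
  unfold basisConst
  rw [e, gamma_add_nat (by linarith), Real.Gamma_nat_eq_factorial, e2, Real.sq_sqrt]
  split_ifs <;> positivity

/-- All normalizations collapse to the weight 1 or 2 that the discrete orthogonality needs. -/
lemma kernelD_eq {μ : ℝ} (hμ : 0 ≤ μ) (k : ℕ) (ξ x y : ℝ) :
    kernelD μ k ξ x y = ∑ l ∈ Finset.range (k / 2 + 1), ∑ ε : Fin 2,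
      (if k - 2 * l = 0 then 1 else 2) *
        diskPoly (μ + 1 / 2) (k - 2 * l) l ε (Real.cos ξ) (Real.sin ξ) *
        diskPoly (μ + 1 / 2) (k - 2 * l) l ε x y := by
  unfold kernelD
  refine Finset.sum_congr rfl fun l hl => Finset.sum_congr rfl fun ε _ => ?_
  obtain ⟨m, rfl⟩ : ∃ m, k = m + 2 * l := ⟨k - 2 * l, by have := Finset.mem_range.mp hl; omega⟩
  rw [diskBasis_eq μ hμ, diskBasis_eq μ hμ, Nat.add_sub_cancel]
  have h1 := HSq_mul_jacobiNormSq hμ m l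
  have h2 := basisConst_sq hμ (m + 2 * l) l
  have hI := jacobiInt_one_pos (by linarith : 0 < μ + 1 / 2) m
  have hN := jacobiNormSq_pos hμ m l
  have hH := HSq_pos hμ (m + 2 * l) l
  have hs := Real.sq_sqrt (div_nonneg hN.le hI.le)
  have hs0 := Real.sqrt_pos.mpr (div_pos hN hI)
  rw [Nat.add_sub_cancel] at h2
  have hcond : (m + 2 * l = 2 * l) = (m = 0) := by simp
  simp only [hcond] at h2
  set δ : ℝ := if m = 0 then 1 else 2
  have key : (HSq μ (m + 2 * l) l)⁻¹ * (basisConst μ (m + 2 * l) l /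
      Real.sqrt (jacobiNormSq (μ + 1 / 2) m l / jacobiInt (μ + 1 / 2) m (fun _ => 1))) ^ 2 = δ := by
    rw [div_pow, hs, h2, eq_div_of_mul_eq hI.ne' h1.symm]
    generalize jacobiNormSq (μ + 1 / 2) m l = N at hN
    generalize jacobiInt (μ + 1 / 2) m (fun _ => 1) = J at hI
    field_simp
  rw [← key]
  ring

/-! ### Reproduction of the basis -/

/-- The surviving term carries `(k + lam)/lam` times the squared norm of `C_k` over `C_k(1)`, which
is the integral of `(1 - s²)^μ`; `chordConst_mul` turns the product of constants into 1. -/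
lemma sum_quadWeight_mul_kernelPhi {μ : ℝ} (hμ : 0 ≤ μ) {n : ℕ} {a : ℝ} {t : Fin (n + 1) → ℝ}
    (ht : Function.Injective t) (hz : ∀ j, (quasiOrthogonal μ a n).IsRoot (t j)) {k : ℕ}
    (hk : k ≤ n) (ξ x y : ℝ) :
    diskConst μ * chordConst μ * ∑ j, quadWeight μ t j *
      (normGegenbauer (μ + 1 / 2) k (t j) * kernelPhi μ n ξ (t j) x y) = kernelD μ k ξ x y := by
  have hlam : 0 < μ + 1 / 2 := by linarith
  have h1 : ∀ k' ∈ Finset.range (n + 1), ∑ j, quadWeight μ t j *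
      ((gegenbauer (μ + 1 / 2) k).eval (t j) * (gegenbauer (μ + 1 / 2) k').eval (t j)) =
      gegenbauerInt μ hμ (gegenbauer (μ + 1 / 2) k * gegenbauer (μ + 1 / 2) k') := by
    intro k' hk'
    rw [← quadrature_exact hμ ht hz]
    · simp only [eval_mul]
    · have := Finset.mem_range.mp hk'
      have := (gegenbauer_degree hlam k).1.1
      have := (gegenbauer_degree hlam k').1.1
      exact natDegree_mul_le.trans (by omega)
  have h2 : ∑ j, quadWeight μ t j *
      (normGegenbauer (μ + 1 / 2) k (t j) * kernelPhi μ n ξ (t j) x y) =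
      ∑ k' ∈ Finset.range (n + 1), ((k' : ℝ) + μ + 1 / 2) / (μ + 1 / 2) * kernelD μ k' ξ x y /
        (gegenbauer (μ + 1 / 2) k).eval 1 *
        gegenbauerInt μ hμ (gegenbauer (μ + 1 / 2) k * gegenbauer (μ + 1 / 2) k') := by
    simp only [kernelPhi, normGegenbauer, Finset.mul_sum]
    rw [Finset.sum_comm]
    refine Finset.sum_congr rfl fun k' hk' => ?_
    rw [← h1 k' hk', Finset.mul_sum]
    refine Finset.sum_congr rfl fun j _ => ?_
    ring
  rw [h2, Finset.sum_eq_single k]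
  · have hp := gegenbauer_eval_one_pos hlam k
    have h3 := gegenbauerInt_gegenbauer_sq hμ k
    have h4 := chordConst_mul hμ
    generalize gegenbauerInt μ hμ (gegenbauer (μ + 1 / 2) k * gegenbauer (μ + 1 / 2) k) = H at h3 ⊢
    generalize (gegenbauer (μ + 1 / 2) k).eval 1 = V at h3 hp ⊢
    generalize μ + 1 / 2 = lam at h3 hlam ⊢
    have e : ((k : ℝ) + μ + 1 / 2) / lam * kernelD μ k ξ x y / V * H =
        (k + μ + 1 / 2) * H / (lam * V) * kernelD μ k ξ x y := by field_simp
    have e2 : lam * (gegenbauerInt μ hμ) 1 * V / (lam * V) = gegenbauerInt μ hμ 1 := by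
      field_simp
    rw [e, h3, e2]
    linear_combination kernelD μ k ξ x y * h4
  · intro k' _ hne
    rw [gegenbauerInt_mul_gegenbauer hμ hne.symm, mul_zero]
  · intro h
    exact absurd (Finset.mem_range.mpr (Nat.lt_succ_of_le hk)) h

/-- Within a fixed degree the frequency `m` determines `l`, so orthogonality in `ξ` alone isolates
one basis polynomial. -/
lemma sum_harmonic_mul_kernelD {μ : ℝ} (hμ : 0 ≤ μ) {n m l : ℕ} (h : m + 2 * l ≤ n) (ε : Fin 2)
    (x y : ℝ) :
    ∑ ν : Fin (n + 1), harmonic m ε (Real.cos (direction n ν)) (Real.sin (direction n ν)) *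
        kernelD μ (m + 2 * l) (direction n ν) x y =
      (n + 1) * diskPoly (μ + 1 / 2) m l ε x y := by
  have h1 : ∀ l' ∈ Finset.range ((m + 2 * l) / 2 + 1), ∀ ε' : Fin 2,
      (if m + 2 * l - 2 * l' = 0 then 1 else 2) * (∑ ν : Fin (n + 1),
        harmonic m ε (Real.cos (direction n ν)) (Real.sin (direction n ν)) *
          harmonic (m + 2 * l - 2 * l') ε' (Real.cos (direction n ν)) (Real.sin (direction n ν))) *
        harmonic (m + 2 * l - 2 * l') ε' x y =
      if l = l' ∧ ε = ε' then (n + 1) * harmonic m ε x y else 0 := by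
    intro l' hl' ε'
    have := Finset.mem_range.mp hl'
    rw [sum_harmonic_mul_harmonic (by omega) (by omega) (by omega)]
    congr 1
    have : m = m + 2 * l - 2 * l' ↔ l = l' := by omega
    rw [this]
  simp only [kernelD_eq hμ, diskPoly_cos_sin, Finset.mul_sum]
  rw [Finset.sum_comm]
  have h2 : ∀ l' ∈ Finset.range ((m + 2 * l) / 2 + 1), (∑ ν : Fin (n + 1), ∑ ε' : Fin 2,
      harmonic m ε (Real.cos (direction n ν)) (Real.sin (direction n ν)) *
        ((if m + 2 * l - 2 * l' = 0 then 1 else 2) *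
          harmonic (m + 2 * l - 2 * l') ε' (Real.cos (direction n ν)) (Real.sin (direction n ν)) *
          diskPoly (μ + 1 / 2) (m + 2 * l - 2 * l') l' ε' x y)) =
      if l = l' then (n + 1) * diskPoly (μ + 1 / 2) m l ε x y else 0 := by
    intro l' hl'
    rw [Finset.sum_comm]
    have h3 : ∀ ε' ∈ Finset.univ, (∑ ν : Fin (n + 1),
        harmonic m ε (Real.cos (direction n ν)) (Real.sin (direction n ν)) *
        ((if m + 2 * l - 2 * l' = 0 then 1 else 2) *
          harmonic (m + 2 * l - 2 * l') ε' (Real.cos (direction n ν)) (Real.sin (direction n ν)) *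
          diskPoly (μ + 1 / 2) (m + 2 * l - 2 * l') l' ε' x y)) =
        normJacobi (μ + 1 / 2) (m + 2 * l - 2 * l') l' (x ^ 2 + y ^ 2 - 1) *
          if l = l' ∧ ε = ε' then (n + 1) * harmonic m ε x y else 0 := by
      intro ε' _
      rw [← h1 l' hl' ε', Finset.mul_sum, Finset.sum_mul, Finset.mul_sum]
      refine Finset.sum_congr rfl fun ν _ => ?_
      unfold diskPoly
      ring
    rw [Finset.sum_congr rfl h3]
    by_cases hll : l = l'
    · subst hll
      simp only [true_and, if_true, Nat.add_sub_cancel, mul_ite, mul_zero, Finset.sum_ite_eq,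
        Finset.mem_univ, diskPoly]
      ring
    · simp [hll]
  rw [Finset.sum_congr rfl h2, Finset.sum_ite_eq, if_pos]
  exact Finset.mem_range.mpr (by omega)

lemma recon_diskPoly {μ : ℝ} (hμ : 0 ≤ μ) {n : ℕ} {a : ℝ} {t : Fin (n + 1) → ℝ}
    (ht_inj : Function.Injective t) (ht_mem : ∀ j, t j ∈ Set.Ioo (-1 : ℝ) 1)
    (ht_zero : ∀ j, (quasiOrthogonal μ a n).IsRoot (t j)) {m l : ℕ} (h : m + 2 * l ≤ n)
    (ε : Fin 2) (x y : ℝ) :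
    recon μ t (diskPoly (μ + 1 / 2) m l ε) x y = diskPoly (μ + 1 / 2) m l ε x y := by
  have hn : (n : ℝ) + 1 ≠ 0 := by positivity
  have h1 (ν : Fin (n + 1)) : ∑ j, radon μ (diskPoly (μ + 1 / 2) m l ε) (direction n ν) (t j) *
      reconT μ t j ν x y = harmonic m ε (Real.cos (direction n ν)) (Real.sin (direction n ν)) *
        kernelD μ (m + 2 * l) (direction n ν) x y / (n + 1) := by
    rw [← sum_quadWeight_mul_kernelPhi hμ ht_inj ht_zero h, Finset.mul_sum, Finset.mul_sum,
      Finset.sum_div]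
    refine Finset.sum_congr rfl fun j _ => ?_
    have h0 : 0 < 1 - t j ^ 2 := by nlinarith [(ht_mem j).1, (ht_mem j).2]
    have h2 : (1 - t j ^ 2) ^ μ * (1 - t j ^ 2) ^ (-μ) = 1 := by
      rw [← Real.rpow_add h0]; simp
    rw [radon_diskPoly hμ (ht_mem j), reconT]
    generalize normGegenbauer (μ + 1 / 2) (m + 2 * l) (t j) = c
    field_simp
    linear_combination (chordConst μ * c *
      harmonic m ε (Real.cos (direction n ν)) (Real.sin (direction n ν)) * diskConst μ *
      quadWeight μ t j * kernelPhi μ n (direction n ν) (t j) x y) * h2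
  unfold recon
  simp only [h1]
  rw [← Finset.sum_div, sum_harmonic_mul_kernelD hμ h]
  field_simp

/-! ### The basis spans the polynomials -/

lemma harmonic_succ_zero (m : ℕ) (x y : ℝ) :
    harmonic (m + 1) 0 x y = x * harmonic m 0 x y - y * harmonic m 1 x y := by
  simp [harmonic, pow_succ]
  ring

lemma harmonic_succ_one (m : ℕ) (x y : ℝ) :
    harmonic (m + 1) 1 x y = x * harmonic m 1 x y + y * harmonic m 0 x y := by
  simp [harmonic, pow_succ]
  ring

/-- The span of the disk polynomials of degree at most `n`. -/
noncomputable def diskSpan (lam : ℝ) (n : ℕ) : Submodule ℝ (ℝ → ℝ → ℝ) :=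
  Submodule.span ℝ {f | ∃ m l ε, m + 2 * l ≤ n ∧ f = diskPoly lam m l ε}

lemma diskPoly_mem_diskSpan (lam : ℝ) {m l n : ℕ} (h : m + 2 * l ≤ n) (ε : Fin 2) :
    diskPoly lam m l ε ∈ diskSpan lam n :=
  Submodule.subset_span ⟨m, l, ε, h, rfl⟩

lemma diskSpan_mono (lam : ℝ) {n n' : ℕ} (h : n ≤ n') : diskSpan lam n ≤ diskSpan lam n' := by
  refine Submodule.span_mono ?_
  rintro f ⟨m, l, ε, h', rfl⟩
  exact ⟨m, l, ε, h'.trans h, rfl⟩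

lemma normJacobi_mul_harmonic_succ_mem {lam : ℝ} (hlam : 0 < lam) (m l : ℕ) (ε : Fin 2) :
    (fun x y => normJacobi lam m l (x ^ 2 + y ^ 2 - 1) * harmonic (m + 1) ε x y) ∈
      diskSpan lam (m + 2 * l + 1) := by
  have hc : (2 * l + lam + m) ≠ 0 := by positivity
  have e : (fun x y => normJacobi lam m l (x ^ 2 + y ^ 2 - 1) * harmonic (m + 1) ε x y) =
      ((l + lam + m) / (2 * l + lam + m)) • diskPoly lam (m + 1) l ε +
        (l / (2 * l + lam + m)) • diskPoly lam (m + 1) (l - 1) ε := by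
    ext x y
    have h := normJacobi_raise (lam := lam) m l (x ^ 2 + y ^ 2 - 1)
    simp only [Pi.add_apply, Pi.smul_apply, smul_eq_mul, diskPoly]
    field_simp
    linear_combination harmonic (m + 1) ε x y * h
  rw [e]
  exact add_mem (Submodule.smul_mem _ _ (diskPoly_mem_diskSpan lam (by omega) ε))
    (Submodule.smul_mem _ _ (diskPoly_mem_diskSpan lam (by omega) ε))

lemma sq_mul_normJacobi_mul_harmonic_mem {lam : ℝ} (hlam : 0 < lam) (m l : ℕ) (ε : Fin 2) :
    (fun x y => (x ^ 2 + y ^ 2) * normJacobi lam (m + 1) l (x ^ 2 + y ^ 2 - 1) *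
      harmonic m ε x y) ∈ diskSpan lam (m + 1 + 2 * l + 1) := by
  have hc : (2 * l + lam + m + 1) ≠ 0 := by positivity
  have e : (fun x y => (x ^ 2 + y ^ 2) * normJacobi lam (m + 1) l (x ^ 2 + y ^ 2 - 1) *
      harmonic m ε x y) =
      ((l + lam) / (2 * l + lam + m + 1)) • diskPoly lam m (l + 1) ε +
        ((l + m + 1) / (2 * l + lam + m + 1)) • diskPoly lam m l ε := by
    ext x y
    have h := normJacobi_lower hlam m l (x ^ 2 + y ^ 2 - 1)
    simp only [Pi.add_apply, Pi.smul_apply, smul_eq_mul, diskPoly]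
    field_simp
    linear_combination harmonic m ε x y * h
  rw [e]
  exact add_mem (Submodule.smul_mem _ _ (diskPoly_mem_diskSpan lam (by omega) ε))
    (Submodule.smul_mem _ _ (diskPoly_mem_diskSpan lam (by omega) ε))

/-- Multiplication by `x` or `y` combines `z^(m+1)` and `|z|² z^(m-1)`, as in `x z^m = (z^(m+1) +
|z|² z^(m-1))/2`. For `m = 0` the second term is absent and `x`, `y` are the harmonics of degree
one. -/
lemma coord_mul_diskPoly_mem {lam : ℝ} (hlam : 0 < lam) (m l : ℕ) (ε : Fin 2) :
    (fun x y => x * diskPoly lam m l ε x y) ∈ diskSpan lam (m + 2 * l + 1) ∧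
      (fun x y => y * diskPoly lam m l ε x y) ∈ diskSpan lam (m + 2 * l + 1) := by
  have hA := normJacobi_mul_harmonic_succ_mem hlam m l
  rcases m with _ | m
  · fin_cases ε
    · refine ⟨?_, ?_⟩
      · convert hA 0 using 3
        simp [diskPoly, harmonic]; ring
      · convert hA 1 using 3
        simp [diskPoly, harmonic]; ring
    · have : diskPoly lam 0 l 1 = 0 := by
        ext x y; simp [diskPoly, harmonic]
      have h0 : (fun _ _ => 0 : ℝ → ℝ → ℝ) ∈ diskSpan lam (0 + 2 * l + 1) := zero_mem _
      simp only [Fin.mk_one, this, Pi.zero_apply, mul_zero]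
      exact ⟨h0, h0⟩
  · have hB := sq_mul_normJacobi_mul_harmonic_mem hlam m l
    have hadd (ε : Fin 2) := Submodule.smul_mem _ (1 / 2 : ℝ) (add_mem (hB ε) (hA ε))
    have hsub (ε : Fin 2) := Submodule.smul_mem _ (1 / 2 : ℝ) (sub_mem (hB ε) (hA ε))
    have hsub' (ε : Fin 2) := Submodule.smul_mem _ (1 / 2 : ℝ) (sub_mem (hA ε) (hB ε))
    fin_cases ε
    · refine ⟨?_, ?_⟩
      · convert hadd 0 using 1
        ext x y
        simp [diskPoly, harmonic_succ_zero, harmonic_succ_one]; ring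
      · convert hsub' 1 using 1
        ext x y
        simp [diskPoly, harmonic_succ_zero, harmonic_succ_one]; ring
    · refine ⟨?_, ?_⟩
      · convert hadd 1 using 1
        ext x y
        simp [diskPoly, harmonic_succ_zero, harmonic_succ_one]; ring
      · convert hsub 0 using 1
        ext x y
        simp [diskPoly, harmonic_succ_zero, harmonic_succ_one]; ring

lemma coord_mul_mem_diskSpan {lam : ℝ} (hlam : 0 < lam) {n : ℕ} {f : ℝ → ℝ → ℝ}
    (hf : f ∈ diskSpan lam n) :
    (fun x y => x * f x y) ∈ diskSpan lam (n + 1) ∧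
      (fun x y => y * f x y) ∈ diskSpan lam (n + 1) := by
  induction hf using Submodule.span_induction with
  | mem f hf =>
    obtain ⟨m, l, ε, h, rfl⟩ := hf
    have := coord_mul_diskPoly_mem hlam m l ε
    exact ⟨diskSpan_mono lam (by omega) this.1, diskSpan_mono lam (by omega) this.2⟩
  | zero =>
    have h0 : (fun _ _ => 0 : ℝ → ℝ → ℝ) ∈ diskSpan lam (n + 1) := zero_mem _
    simpa using h0
  | add f g _ _ hf hg =>
    simp only [Pi.add_apply, mul_add]
    exact ⟨add_mem hf.1 hg.1, add_mem hf.2 hg.2⟩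
  | smul c f _ hf =>
    simp only [Pi.smul_apply, smul_eq_mul, mul_left_comm _ c]
    exact ⟨Submodule.smul_mem _ c hf.1, Submodule.smul_mem _ c hf.2⟩

lemma monomial_mem_diskSpan {lam : ℝ} (hlam : 0 < lam) (i j : ℕ) :
    (fun x y => x ^ i * y ^ j) ∈ diskSpan lam (i + j) := by
  induction i with
  | zero =>
    induction j with
    | zero =>
      convert diskPoly_mem_diskSpan lam (m := 0) (l := 0) (n := 0) le_rfl 0 using 3
      simp [diskPoly, harmonic]
    | succ j ih =>
      have := (coord_mul_mem_diskSpan hlam ih).2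
      simp only [pow_zero, one_mul] at this ⊢
      simpa only [pow_succ', add_assoc] using this
  | succ i ih =>
    have := (coord_mul_mem_diskSpan hlam ih).1
    simp only [← mul_assoc, ← pow_succ'] at this
    rwa [add_right_comm]

lemma eval_mem_diskSpan {lam : ℝ} (hlam : 0 < lam) {n : ℕ} {P : MvPolynomial (Fin 2) ℝ}
    (hP : P ∈ MvPolynomial.restrictTotalDegree (Fin 2) ℝ n) :
    (fun x y => MvPolynomial.eval ![x, y] P) ∈ diskSpan lam n := by
  rw [MvPolynomial.mem_restrictTotalDegree] at hP
  have e : (fun x y => MvPolynomial.eval ![x, y] P) =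
      ∑ d ∈ P.support, P.coeff d • fun x y : ℝ => x ^ d 0 * y ^ d 1 := by
    ext x y
    simp [MvPolynomial.eval_eq', Finset.sum_apply]
  rw [e]
  refine Submodule.sum_mem _ fun d hd => Submodule.smul_mem _ _ ?_
  have h := MvPolynomial.le_totalDegree hd
  rw [Finsupp.sum_fintype _ _ (fun _ => rfl), Fin.sum_univ_two] at h
  exact diskSpan_mono lam (h.trans hP) (monomial_mem_diskSpan hlam _ _)

/-! ### Linearity of the reconstruction operator -/

lemma intervalIntegrable_radon {μ : ℝ} (hμ : 0 ≤ μ) {t : ℝ} (ht : t ∈ Set.Ioo (-1 : ℝ) 1)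
    {f : ℝ → ℝ → ℝ} (hf : Continuous (Function.uncurry f)) (θ : ℝ) :
    IntervalIntegrable (fun s => f (t * Real.cos θ - s * Real.sin θ)
        (t * Real.sin θ + s * Real.cos θ) * diskWeight μ s t) MeasureTheory.volume
      (-Real.sqrt (1 - t ^ 2)) (Real.sqrt (1 - t ^ 2)) := by
  have : Continuous fun s => f (t * Real.cos θ - s * Real.sin θ)
      (t * Real.sin θ + s * Real.cos θ) :=
    hf.comp (by fun_prop : Continuous fun s : ℝ =>
      (t * Real.cos θ - s * Real.sin θ, t * Real.sin θ + s * Real.cos θ))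
  exact (intervalIntegrable_diskWeight hμ ht).continuousOn_mul this.continuousOn

lemma recon_add {μ : ℝ} (hμ : 0 ≤ μ) {n : ℕ} {t : Fin (n + 1) → ℝ}
    (ht : ∀ j, t j ∈ Set.Ioo (-1 : ℝ) 1) {f g : ℝ → ℝ → ℝ}
    (hf : Continuous (Function.uncurry f)) (hg : Continuous (Function.uncurry g)) (x y : ℝ) :
    recon μ t (f + g) x y = recon μ t f x y + recon μ t g x y := by
  unfold recon
  simp only [← Finset.sum_add_distrib]
  refine Finset.sum_congr rfl fun ν _ => Finset.sum_congr rfl fun j _ => ?_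
  rw [← add_mul]
  congr 1
  unfold radon
  rw [← intervalIntegral.integral_add (intervalIntegrable_radon hμ (ht j) hf _)
    (intervalIntegrable_radon hμ (ht j) hg _)]
  simp only [Pi.add_apply, add_mul]

lemma recon_smul (μ : ℝ) {n : ℕ} (t : Fin (n + 1) → ℝ) (c : ℝ) (f : ℝ → ℝ → ℝ) (x y : ℝ) :
    recon μ t (c • f) x y = c * recon μ t f x y := by
  unfold recon
  simp only [Finset.mul_sum]
  refine Finset.sum_congr rfl fun ν _ => Finset.sum_congr rfl fun j _ => ?_
  rw [← mul_assoc]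
  congr 1
  unfold radon
  rw [← intervalIntegral.integral_const_mul]
  simp only [Pi.smul_apply, smul_eq_mul, mul_assoc]

/-- Continuity travels through the induction because additivity of the chord integrals needs
integrability. -/
lemma recon_eq_of_mem_diskSpan {μ : ℝ} (hμ : 0 ≤ μ) {n : ℕ} {a : ℝ} {t : Fin (n + 1) → ℝ}
    (ht_inj : Function.Injective t) (ht_mem : ∀ j, t j ∈ Set.Ioo (-1 : ℝ) 1)
    (ht_zero : ∀ j, (quasiOrthogonal μ a n).IsRoot (t j)) {f : ℝ → ℝ → ℝ}
    (hf : f ∈ diskSpan (μ + 1 / 2) n) :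
    Continuous (Function.uncurry f) ∧ ∀ x y, recon μ t f x y = f x y := by
  induction hf using Submodule.span_induction with
  | mem f hf =>
    obtain ⟨m, l, ε, h, rfl⟩ := hf
    refine ⟨?_, recon_diskPoly hμ ht_inj ht_mem ht_zero h ε⟩
    unfold diskPoly harmonic
    have := continuous_normJacobi (μ + 1 / 2) m l
    simp only [Function.uncurry_def]
    split_ifs <;> fun_prop
  | zero =>
    refine ⟨continuous_const, fun x y => ?_⟩
    simp [recon, radon]
  | add f g _ _ hf hg =>
    refine ⟨hf.1.add hg.1, fun x y => ?_⟩
    rw [recon_add hμ ht_mem hf.1 hg.1, hf.2, hg.2]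
    rfl
  | smul c f _ hf =>
    refine ⟨hf.1.const_smul c, fun x y => ?_⟩
    rw [recon_smul, hf.2]
    rfl

/-! ### The range of the reconstruction operator -/

/-- The functions given by polynomials in two variables of total degree at most `n`. -/
noncomputable def polyFun (n : ℕ) : Submodule ℝ (ℝ → ℝ → ℝ) where
  carrier := {f | ∃ Q ∈ MvPolynomial.restrictTotalDegree (Fin 2) ℝ n,
    ∀ x y : ℝ, f x y = MvPolynomial.eval ![x, y] Q}
  add_mem' := by
    rintro f g ⟨P, hP, hf⟩ ⟨Q, hQ, hg⟩
    exact ⟨P + Q, add_mem hP hQ, fun x y => by simp [hf, hg]⟩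
  zero_mem' := ⟨0, zero_mem _, fun x y => by simp⟩
  smul_mem' := by
    rintro c f ⟨P, hP, hf⟩
    exact ⟨c • P, Submodule.smul_mem _ c hP, fun x y => by simp [hf, MvPolynomial.smul_eval]⟩

lemma polyFun_mono {n n' : ℕ} (h : n ≤ n') : polyFun n ≤ polyFun n' := by
  rintro f ⟨P, hP, hf⟩
  rw [MvPolynomial.mem_restrictTotalDegree] at hP
  exact ⟨P, (MvPolynomial.mem_restrictTotalDegree _ _ _).mpr (hP.trans h), hf⟩

lemma mul_mem_polyFun {n n' : ℕ} {f g : ℝ → ℝ → ℝ} (hf : f ∈ polyFun n) (hg : g ∈ polyFun n') :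
    (fun x y => f x y * g x y) ∈ polyFun (n + n') := by
  obtain ⟨P, hP, hf⟩ := hf
  obtain ⟨Q, hQ, hg⟩ := hg
  rw [MvPolynomial.mem_restrictTotalDegree] at hP hQ
  exact ⟨P * Q, (MvPolynomial.mem_restrictTotalDegree _ _ _).mpr
    ((MvPolynomial.totalDegree_mul P Q).trans (add_le_add hP hQ)), fun x y => by simp [hf, hg]⟩

lemma one_mem_polyFun : (fun _ _ => 1 : ℝ → ℝ → ℝ) ∈ polyFun 0 :=
  ⟨1, (MvPolynomial.mem_restrictTotalDegree _ _ _).mpr (by simp), fun x y => by simp⟩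

lemma fst_mem_polyFun : (fun x _ => x : ℝ → ℝ → ℝ) ∈ polyFun 1 :=
  ⟨MvPolynomial.X 0, (MvPolynomial.mem_restrictTotalDegree _ _ _).mpr (by simp),
    fun x y => by simp⟩

lemma snd_mem_polyFun : (fun _ y => y : ℝ → ℝ → ℝ) ∈ polyFun 1 :=
  ⟨MvPolynomial.X 1, (MvPolynomial.mem_restrictTotalDegree _ _ _).mpr (by simp),
    fun x y => by simp⟩

lemma pow_mem_polyFun {n : ℕ} {f : ℝ → ℝ → ℝ} (hf : f ∈ polyFun n) (j : ℕ) :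
    (fun x y => f x y ^ j) ∈ polyFun (n * j) := by
  induction j with
  | zero => simpa using one_mem_polyFun
  | succ j ih =>
    simp only [pow_succ]
    exact mul_mem_polyFun ih hf

lemma harmonic_mem_polyFun (m : ℕ) :
    harmonic m 0 ∈ polyFun m ∧ harmonic m 1 ∈ polyFun m := by
  induction m with
  | zero =>
    refine ⟨?_, ?_⟩
    · convert one_mem_polyFun using 3
      simp [harmonic]
    · convert zero_mem (polyFun 0) using 1
      ext x y
      simp [harmonic]
  | succ m ih =>
    have e0 : harmonic (m + 1) 0 =
        (fun x y => harmonic m 0 x y * x) - fun x y => harmonic m 1 x y * y := by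
      ext x y
      simp only [Pi.sub_apply, harmonic_succ_zero]
      ring
    have e1 : harmonic (m + 1) 1 =
        (fun x y => harmonic m 1 x y * x) + fun x y => harmonic m 0 x y * y := by
      ext x y
      simp only [Pi.add_apply, harmonic_succ_one]
      ring
    rw [e0, e1]
    exact ⟨sub_mem (mul_mem_polyFun ih.1 fst_mem_polyFun) (mul_mem_polyFun ih.2 snd_mem_polyFun),
      add_mem (mul_mem_polyFun ih.2 fst_mem_polyFun) (mul_mem_polyFun ih.1 snd_mem_polyFun)⟩

lemma diskPoly_mem_polyFun (lam : ℝ) (m l : ℕ) (ε : Fin 2) :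
    diskPoly lam m l ε ∈ polyFun (m + 2 * l) := by
  have hw : (fun x y : ℝ => x ^ 2 + y ^ 2 - 1) ∈ polyFun 2 :=
    sub_mem (add_mem (pow_mem_polyFun fst_mem_polyFun 2) (pow_mem_polyFun snd_mem_polyFun 2))
      (polyFun_mono (Nat.zero_le 2) one_mem_polyFun)
  have hN : (fun x y : ℝ => normJacobi lam m l (x ^ 2 + y ^ 2 - 1)) ∈ polyFun (2 * l) := by
    have e : (fun x y : ℝ => normJacobi lam m l (x ^ 2 + y ^ 2 - 1)) =
        ∑ j ∈ Finset.range (l + 1), ((l.choose j : ℝ) * poch (lam + m + l) j / poch lam j) •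
          fun x y : ℝ => (x ^ 2 + y ^ 2 - 1) ^ j := by
      ext x y
      simp [normJacobi, Finset.sum_apply]
    rw [e]
    refine Submodule.sum_mem _ fun j hj => Submodule.smul_mem _ _ ?_
    have := Finset.mem_range.mp hj
    exact polyFun_mono (by omega) (pow_mem_polyFun hw j)
  have hh : harmonic m ε ∈ polyFun m := by
    fin_cases ε
    exacts [(harmonic_mem_polyFun m).1, (harmonic_mem_polyFun m).2]
  rw [add_comm]
  exact mul_mem_polyFun hN hh

lemma reconT_mem_polyFun {μ : ℝ} (hμ : 0 ≤ μ) {n : ℕ} (t : Fin (n + 1) → ℝ) (j ν : Fin (n + 1)) :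
    reconT μ t j ν ∈ polyFun n := by
  have hD : ∀ k ≤ n, kernelD μ k (direction n ν) ∈ polyFun n := by
    intro k hk
    have e : kernelD μ k (direction n ν) = ∑ l ∈ Finset.range (k / 2 + 1), ∑ ε : Fin 2,
        ((if k - 2 * l = 0 then 1 else 2) * diskPoly (μ + 1 / 2) (k - 2 * l) l ε
          (Real.cos (direction n ν)) (Real.sin (direction n ν))) •
        diskPoly (μ + 1 / 2) (k - 2 * l) l ε := by
      ext x y
      simp only [kernelD_eq hμ, Finset.sum_apply, Pi.smul_apply, smul_eq_mul]
    rw [e]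
    refine Submodule.sum_mem _ fun l hl => Submodule.sum_mem _ fun ε _ =>
      Submodule.smul_mem _ _ ?_
    have := Finset.mem_range.mp hl
    exact polyFun_mono (by omega) (diskPoly_mem_polyFun _ _ _ _)
  have e : reconT μ t j ν = (diskConst μ * quadWeight μ t j / ((n : ℝ) + 1) *
      (1 - t j ^ 2) ^ (-μ)) • ∑ k ∈ Finset.range (n + 1),
        (((k : ℝ) + μ + 1 / 2) / (μ + 1 / 2) * (gegenbauer (μ + 1 / 2) k).eval (t j)) •
          kernelD μ k (direction n ν) := by
    ext x y
    simp [reconT, kernelPhi, Finset.sum_apply]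
  rw [e]
  refine Submodule.smul_mem _ _ (Submodule.sum_mem _ fun k hk => Submodule.smul_mem _ _ (hD k ?_))
  exact Nat.lt_succ_iff.mp (Finset.mem_range.mp hk)

/-- The data enter only as scalar coefficients, so `f` may be arbitrary: a chord integral that does
not exist has the default value 0. -/
lemma recon_mem_polyFun {μ : ℝ} (hμ : 0 ≤ μ) {n : ℕ} (t : Fin (n + 1) → ℝ) (f : ℝ → ℝ → ℝ) :
    recon μ t f ∈ polyFun n := by
  have e : recon μ t f = ∑ ν : Fin (n + 1), ∑ j : Fin (n + 1),
      radon μ f (direction n ν) (t j) • reconT μ t j ν := by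
    ext x y
    simp [recon, Finset.sum_apply]
  rw [e]
  exact Submodule.sum_mem _ fun ν _ => Submodule.sum_mem _ fun j _ =>
    Submodule.smul_mem _ _ (reconT_mem_polyFun hμ t j ν)

end AttenuatedRadon

theorem theorem2p14 (μ : ℝ) (hμ : 0 ≤ μ) (n : ℕ) (a : ℝ) (t : Fin (n + 1) → ℝ)
    (ht_inj : Function.Injective t)
    (ht_mem : ∀ j, t j ∈ Set.Ioo (-1 : ℝ) 1)
    (ht_zero : ∀ j, (AttenuatedRadon.quasiOrthogonal μ a n).IsRoot (t j)) :
    (∀ f : ℝ → ℝ → ℝ, ∃ Q ∈ MvPolynomial.restrictTotalDegree (Fin 2) ℝ n,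
      ∀ x y : ℝ, AttenuatedRadon.recon μ t f x y = MvPolynomial.eval ![x, y] Q) ∧
    (∀ P ∈ MvPolynomial.restrictTotalDegree (Fin 2) ℝ n,
      ∀ x y : ℝ, AttenuatedRadon.recon μ t (fun u v => MvPolynomial.eval ![u, v] P) x y =
        MvPolynomial.eval ![x, y] P) := by
  refine ⟨fun f => AttenuatedRadon.recon_mem_polyFun hμ t f, fun P hP => ?_⟩
  exact (AttenuatedRadon.recon_eq_of_mem_diskSpan hμ ht_inj ht_mem ht_zero
    (AttenuatedRadon.eval_mem_diskSpan (by linarith) hP)).2
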